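/- Let $d\ge 1$ and let $(\Omega,\mathcal F,\mathbb P,\{T^z\}_{z\in\mathbb Z^d})$ be a probability-measure-preserving $\mathbb Z^d$-system. Let $\alpha:\Omega\to\{\pm e_1,\dots,\pm e_d\}$ be measurable; in the configuration $\omega$ the lattice point $z$ carries the arrow $\alpha(T^z\omega)$. For $x\in\mathbb Z^d$ the walk $X_x(\omega,\cdot)$ is given by $X_x(\omega,0)=x$ and $X_x(\omega,n+1)=X_x(\omega,n)+\alpha(T^{X_x(\omega,n)}\omega)$. A bi-infinite trajectory of $\omega$ is a map $\gamma:\mathbb Z\to\mathbb Z^d$ with $\gamma(k+1)=\gamma(k)+\alpha(T^{\gamma(k)}\omega)$ for all $k\in\mathbb Z$. Let $\mathcal S$ be the event that the origin lies on a bi-infinite trajectory, $T_\alpha\omega=T^{\alpha(\omega)}\omega$, and $\mathbb P_\alpha(A)=\mathbb P(A\cap\mathcal S)$. A sequence $(x_n)$ in $\mathbb Z^d$ has asymptotic velocity $v$ if $x_n/n\to v$, and asymptotic direction $u$ (a Euclidean unit vector) if $x_n/\|x_n\|\to u$. The walks are directed if $\alpha\in\{e_1,\dots,e_d\}$ everywhere.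 They are line-crossing if for some non-zero $\ell\in\mathbb Z^d$, almost surely every walk meets every hyperplane $\{x:\ell\cdot x=c\}$, $c\in\mathbb Z$, at most finitely often. (In $d=2$, vertical, horizontal and diagonal lines are special cases.) Then: 1. $\mathcal S$ is measurable, $T_\alpha$ maps $\mathcal S$ into itself and preserves $\mathbb P_\alpha$, and there is a measurable $\mathcal S'\subseteq\mathcal S$ with $\mathbb P(\mathcal S\setminus\mathcal S')=0$ on which $T_\alpha$ restricts to a bijection $\mathcal S'\to\mathcal S'$, bimeasurable and measure-preserving. That is, $T_\alpha$ generates a measure-preserving $\mathbb Z$-action on $\mathcal S$ (mod null sets). 2. Almost surely, for every bi-infinite trajectory $\gamma$ there is $v\in\mathbb R^d$ with $\gamma(n)/n\to v$ and $\gamma(-n)/n\to -v$ as $n\to\infty$. If the walks are line-crossing or directed, then almost surely $v\neq 0$ for every bi-infinite trajectory, so that $\gamma(n)$ and $\gamma(-n)$ have the asymptotic directions $v/\|v\|$ and $-v/\|v\|$. 3. Let $d=2$. (a) Almost surely there is a unit vector $u$ such that the asymptotic velocities of all bi-infinite trajectories of the configuration are multiples of $u$. (b) If the walks are line-crossing,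 then almost surely, if the configuration contains a bi-infinite trajectory, there is a unit vector $u$ such that every walk $X_x$, $x\in\mathbb Z^2$ (on a bi-infinite trajectory or not), has asymptotic direction $u$ or $-u$. (c) If the walks are directed, then almost surely, if the configuration contains a bi-infinite trajectory, there is a unit vector $u$ such that every walk $X_x$, $x\in\mathbb Z^2$, has asymptotic direction $u$. 4. If $d=2$ and the $\mathbb Z^2$-system is ergodic, then the vector $u$ in each of 3(a), 3(b) and 3(c) can be chosen deterministic (independent of $\omega$). -/

import Mathlib

open MeasureTheory Filter Topology

namespace ArrowWalk

variable {d : ℕ} {Ω : Type*}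

/-- `α` takes values in `{±e₁, …, ±e_d}`. -/
def IsArrowField (α : Ω → (Fin d → ℤ)) : Prop :=
  ∀ ω, ∃ i, α ω = Pi.single i 1 ∨ α ω = -Pi.single i 1

/-- Directed arrows: `α` takes values in `{e₁, …, e_d}`. -/
def IsDirected (α : Ω → (Fin d → ℤ)) : Prop :=
  ∀ ω, ∃ i, α ω = Pi.single i 1

/-- A point of `ℤ^d` seen in Euclidean space. -/
noncomputable def toEuc (x : Fin d → ℤ) : EuclideanSpace ℝ (Fin d) :=
  WithLp.toLp 2 (fun i => (x i : ℝ))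

section action

variable [AddAction (Fin d → ℤ) Ω]

/-- The walk `X_x(ω, ·)` which starts at `x` and follows the arrows of the configuration `ω`;
the arrow at the lattice point `z` is `α (T^z ω)`, with `T^z ω = z +ᵥ ω`. -/
def walk (α : Ω → (Fin d → ℤ)) (ω : Ω) (x : Fin d → ℤ) : ℕ → (Fin d → ℤ)
  | 0 => x
  | n + 1 => walk α ω x n + α (walk α ω x n +ᵥ ω)

/-- `γ` is a bi-infinite trajectory of the configuration `ω`: a doubly infinite path
which follows the arrows. -/
def IsBiinfinite (α : Ω → (Fin d → ℤ)) (ω : Ω) (γ : ℤ → (Fin d → ℤ)) : Prop :=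
  ∀ k : ℤ, γ (k + 1) = γ k + α (γ k +ᵥ ω)

/-- The event that the origin lies on a bi-infinite trajectory. -/
def biinfiniteSet (α : Ω → (Fin d → ℤ)) : Set Ω :=
  {ω | ∃ γ : ℤ → (Fin d → ℤ), IsBiinfinite α ω γ ∧ γ 0 = 0}

/-- The map `T_α ω = T^{α(ω)} ω`, which moves the origin along its arrow. -/
def arrowMap (α : Ω → (Fin d → ℤ)) (ω : Ω) : Ω := α ω +ᵥ ω

/-- Almost surely, every walk meets each hyperplane `{x | ∑ i, ℓ i * x i = c}`, `c ∈ ℤ`,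
at most finitely many times. -/
def LineCrossing [MeasurableSpace Ω] (P : Measure Ω) (α : Ω → (Fin d → ℤ))
    (l : Fin d → ℤ) : Prop :=
  ∀ᵐ ω ∂P, ∀ (x : Fin d → ℤ) (c : ℤ), {n : ℕ | ∑ i, l i * walk α ω x n i = c}.Finite

end action

/-- `x n / n → v`. -/
def HasAsymptoticVelocity (x : ℕ → (Fin d → ℤ)) (v : EuclideanSpace ℝ (Fin d)) : Prop :=
  Tendsto (fun n : ℕ => (n : ℝ)⁻¹ • toEuc (x n)) atTop (𝓝 v)

/-- `x n / ‖x n‖ → u`, with `u` a unit vector. -/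
def HasAsymptoticDirection (x : ℕ → (Fin d → ℤ)) (u : EuclideanSpace ℝ (Fin d)) : Prop :=
  ‖u‖ = 1 ∧ Tendsto (fun n : ℕ => ‖toEuc (x n)‖⁻¹ • toEuc (x n)) atTop (𝓝 u)

/-- `f` makes `S`, with the trace `σ`-algebra and the measure `A ↦ P (A ∩ S)`, into an
invertible measure-preserving `ℤ`-system: `S` is measurable, `f` maps `S` into `S` and preserves
`P` restricted to `S`, and, after removing a `P`-null set from `S`, `f` is a
measure-preserving bijection with measurable inverse
(whose integer powers are then a measure-preserving action of `ℤ`). -/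
def IsInvertibleSystemOn [MeasurableSpace Ω] (P : Measure Ω) (S : Set Ω) (f : Ω → Ω) : Prop :=
  MeasurableSet S ∧ Set.MapsTo f S S ∧
    MeasurePreserving f (P.restrict S) (P.restrict S) ∧
    ∃ S' : Set Ω, S' ⊆ S ∧ MeasurableSet S' ∧ P (S \ S') = 0 ∧
      ∃ e : S' ≃ᵐ S', (∀ ω : S', (e ω : Ω) = f ω) ∧
        MeasurePreserving e (P.comap Subtype.val) (P.comap Subtype.val)

end ArrowWalk

namespace ArrowWalk

section Birkhoff

variable {X : Type*}

/-- The maximum of the Birkhoff sums `S_k f`, `0 ≤ k ≤ n`. -/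
def maxBirkhoffSum (T : X → X) (f : X → ℝ) : ℕ → X → ℝ
  | 0, _ => 0
  | n + 1, x => max 0 (f x + maxBirkhoffSum T f n (T x))

lemma maxBirkhoffSum_nonneg (T : X → X) (f : X → ℝ) (n : ℕ) (x : X) :
    0 ≤ maxBirkhoffSum T f n x := by
  cases n with
  | zero => exact le_rfl
  | succ n => exact le_max_left _ _

lemma maxBirkhoffSum_le_succ (T : X → X) (f : X → ℝ) (n : ℕ) (x : X) :
    maxBirkhoffSum T f n x ≤ maxBirkhoffSum T f (n + 1) x := by
  induction n generalizing x with
  | zero => exact maxBirkhoffSum_nonneg _ _ _ _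
  | succ n ih => exact max_le_max le_rfl (by linarith [ih (T x)])

lemma birkhoffSum_le_maxBirkhoffSum (T : X → X) (f : X → ℝ) (n : ℕ) (x : X) :
    birkhoffSum T f n x ≤ maxBirkhoffSum T f n x := by
  induction n generalizing x with
  | zero => simp [maxBirkhoffSum]
  | succ n ih =>
    rw [birkhoffSum_succ']
    exact le_max_of_le_right (by linarith [ih (T x)])

lemma measurable_maxBirkhoffSum [MeasurableSpace X] {T : X → X} (hT : Measurable T) {f : X → ℝ} (hf : Measurable f)
    (n : ℕ) : Measurable (maxBirkhoffSum T f n) := by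
  induction n with
  | zero => exact measurable_const
  | succ n ih => exact measurable_const.max (hf.add (ih.comp hT))

lemma abs_maxBirkhoffSum_le {T : X → X} {f : X → ℝ} {C : ℝ} (hC : ∀ x, |f x| ≤ C) (n : ℕ)
    (x : X) : |maxBirkhoffSum T f n x| ≤ n * C := by
  rw [abs_of_nonneg (maxBirkhoffSum_nonneg _ _ _ _)]
  have hC0 : 0 ≤ C := (abs_nonneg _).trans (hC x)
  induction n generalizing x with
  | zero => simp [maxBirkhoffSum]
  | succ n ih =>
    refine max_le (by positivity) ?_
    push_cast
    linarith [ih (T x), (abs_le.1 (hC x)).2]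

/-- The **maximal ergodic inequality**. -/
theorem integral_nonneg_of_birkhoffSum_pos [MeasurableSpace X] {T : X → X} {ν : Measure X} [IsFiniteMeasure ν]
    (hT : MeasurePreserving T ν ν) {f : X → ℝ} (hf : Measurable f) {C : ℝ}
    (hC : ∀ x, |f x| ≤ C) (h : ∀ᵐ x ∂ν, ∃ n, 0 < birkhoffSum T f n x) : 0 ≤ ∫ x, f x ∂ν := by
  set M := maxBirkhoffSum T f with hM
  have hMm : ∀ n, Measurable (M n) := measurable_maxBirkhoffSum hT.measurable hf
  have hMi : ∀ n, Integrable (M n) ν := fun n =>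
    Integrable.of_bound (hMm n).aestronglyMeasurable (n * C)
      (ae_of_all _ fun x => abs_maxBirkhoffSum_le hC n x)
  have hMTi : ∀ n, Integrable (fun x => M n (T x)) ν := fun n =>
    hT.integrable_comp_of_integrable (hMi n)
  have hfi : Integrable f ν := Integrable.of_bound hf.aestronglyMeasurable C (ae_of_all _ hC)
  have hpos : ∀ n, MeasurableSet {x | 0 < M n x} := fun n =>
    measurableSet_lt measurable_const (hMm n)
  have key : ∀ n, 0 ≤ ∫ x, {x | 0 < M (n + 1) x}.indicator f x ∂ν := by
    intro n
    have h1 : ∫ x, M (n + 1) (T x) ∂ν = ∫ x, M (n + 1) x ∂ν := by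
      rw [← integral_map hT.measurable.aemeasurable (by
        rw [hT.map_eq]; exact (hMm _).aestronglyMeasurable), hT.map_eq]
    have h2 : ∫ x, M (n + 1) x ∂ν ≤
        ∫ x, ({x | 0 < M (n + 1) x}.indicator f x + M (n + 1) (T x)) ∂ν := by
      refine integral_mono (hMi _) ((hfi.indicator (hpos _)).add
        (hMTi _)) fun x => ?_
      by_cases hx : 0 < M (n + 1) x
      · simp only [Set.indicator_of_mem (show x ∈ {x | 0 < M (n + 1) x} from hx)]
        have h3 := maxBirkhoffSum_le_succ T f n (T x)
        have h4 : M (n + 1) x = max 0 (f x + M n (T x)) := rfl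
        rw [h4] at hx ⊢
        rcases lt_max_iff.1 hx with h | h
        · exact absurd h (lt_irrefl _)
        · rw [max_eq_right h.le]; linarith
      · simp only [Set.indicator_of_notMem (show x ∉ {x | 0 < M (n + 1) x} from hx)]
        linarith [maxBirkhoffSum_nonneg T f (n + 1) (T x), not_lt.1 hx]
    rw [integral_add (hfi.indicator (hpos _)) (hMTi _), h1] at h2
    linarith
  have hlim : Tendsto (fun n => ∫ x, {x | 0 < M (n + 1) x}.indicator f x ∂ν) atTop
      (𝓝 (∫ x, f x ∂ν)) := by
    refine tendsto_integral_of_dominated_convergence (fun _ => C)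
      (fun n => (hf.indicator (hpos _)).aestronglyMeasurable) (integrable_const _)
      (fun n => ae_of_all _ fun x => ?_) ?_
    · exact (norm_indicator_le_norm_self _ _).trans (hC x)
    · filter_upwards [h] with x hx
      obtain ⟨n, hn⟩ := hx
      refine tendsto_const_nhds.congr' ?_
      filter_upwards [eventually_ge_atTop n] with m hm
      have hmono : Monotone fun n => M n x :=
        monotone_nat_of_le_succ fun n => maxBirkhoffSum_le_succ T f n x
      have : 0 < M (m + 1) x := (hn.trans_le (birkhoffSum_le_maxBirkhoffSum T f n x)).trans_le
        (hmono (by lia))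
      rw [Set.indicator_of_mem (show x ∈ {x | 0 < M (m + 1) x} from this)]
  exact ge_of_tendsto' hlim key

/-- If some Birkhoff average exceeds `b` at almost every point of an invariant set, then
so does the space average over that set. -/
lemma mul_measureReal_le_setIntegral [MeasurableSpace X] {T : X → X} {μ : Measure X} [IsFiniteMeasure μ]
    (hT : MeasurePreserving T μ μ) {f : X → ℝ} (hf : Measurable f) {C : ℝ}
    (hC : ∀ x, |f x| ≤ C) {E : Set X} (hE : MeasurableSet E) (hTE : T ⁻¹' E = E) {b : ℝ}
    (h : ∀ x ∈ E, ∃ n, b < birkhoffAverage ℝ T f n x ∧ n ≠ 0) :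
    b * μ.real E ≤ ∫ x in E, f x ∂μ := by
  have hTE' : MeasurePreserving T (μ.restrict E) (μ.restrict E) := by
    have := hT.restrict_preimage hE
    rwa [hTE] at this
  have hfi : Integrable f (μ.restrict E) :=
    Integrable.of_bound hf.aestronglyMeasurable C (ae_of_all _ hC)
  have := integral_nonneg_of_birkhoffSum_pos (f := fun x => f x - b) hTE' (hf.sub_const b)
    (C := C + |b|) (fun x => (abs_sub _ _).trans (by linarith [hC x])) ?_
  · rw [integral_sub hfi (integrable_const _)] at this
    simp at this
    linarith
  · refine ae_restrict_of_forall_mem hE fun x hx => ?_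
    obtain ⟨n, hn, hn0⟩ := h x hx
    refine ⟨n, ?_⟩
    have hn' : (0 : ℝ) < n := by positivity
    have : birkhoffSum T (fun x => f x - b) n x = birkhoffSum T f n x - n * b := by
      simp [birkhoffSum]
    rw [this]
    rw [birkhoffAverage, smul_eq_mul, ← div_eq_inv_mul, lt_div_iff₀ hn'] at hn
    linarith

lemma measurable_birkhoffAverage [MeasurableSpace X] {T : X → X} (hT : Measurable T) {f : X → ℝ}
    (hf : Measurable f) (n : ℕ) : Measurable (birkhoffAverage ℝ T f n) := by
  have : Measurable fun x => ∑ k ∈ Finset.range n, f (T^[k] x) :=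
    Finset.measurable_sum _ fun k _ => hf.comp (hT.iterate k)
  exact this.const_mul _

/-- The points whose Birkhoff averages have lower limit less than `a`. -/
def lowAverages (T : X → X) (f : X → ℝ) (a : ℝ) : Set X :=
  {x | ∃ q : ℚ, (q : ℝ) < a ∧ ∃ᶠ n in atTop, birkhoffAverage ℝ T f n x < q}

lemma measurableSet_lowAverages [MeasurableSpace X] {T : X → X} (hT : Measurable T) {f : X → ℝ} (hf : Measurable f)
    (a : ℝ) : MeasurableSet (lowAverages T f a) := by
  simp only [lowAverages, frequently_atTop, Set.ofPred_exists, Set.ofPred_and, Set.ofPred_forall]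
  refine MeasurableSet.iUnion fun q => (MeasurableSet.const _).inter (MeasurableSet.iInter
    fun N => MeasurableSet.iUnion fun n => (MeasurableSet.const _).inter ?_)
  exact measurableSet_lt (measurable_birkhoffAverage hT hf n) measurable_const

lemma preimage_lowAverages (T : X → X) {f : X → ℝ} {C : ℝ} (hC : ∀ x, |f x| ≤ C) (a : ℝ) :
    T ⁻¹' lowAverages T f a = lowAverages T f a := by
  ext x
  have hb : Bornology.IsBounded (Set.range f) :=
    (isBounded_iff_forall_norm_le).2 ⟨C, by rintro _ ⟨x, rfl⟩; exact hC x⟩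
  have ht := tendsto_birkhoffAverage_apply_sub_birkhoffAverage' ℝ hb T x
  rw [Metric.tendsto_atTop'] at ht
  constructor
  all_goals
    rintro ⟨q, hq, h⟩
    obtain ⟨q', hq', hq'a⟩ := exists_rat_btwn hq
    refine ⟨q', hq'a, ?_⟩
    obtain ⟨N, hN⟩ := ht (q' - q) (by linarith)
    refine (h.and_eventually (eventually_gt_atTop N)).mono fun n hn => ?_
    have := hN n hn.2
    rw [dist_zero_right, Real.norm_eq_abs, abs_lt] at this
    linarith [hn.1, this.1, this.2]

lemma birkhoffAverage_neg_apply (T : X → X) (f : X → ℝ) (n : ℕ) (x : X) :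
    birkhoffAverage ℝ T (fun x => -f x) n x = -birkhoffAverage ℝ T f n x := by
  simp [birkhoffAverage, birkhoffSum]

lemma exists_birkhoffAverage_lt {T : X → X} {f : X → ℝ} {a : ℝ} {x : X}
    (hx : x ∈ lowAverages T f a) : ∃ n, birkhoffAverage ℝ T f n x < a ∧ n ≠ 0 := by
  obtain ⟨q, hq, h⟩ := hx
  obtain ⟨n, hn⟩ := (h.and_eventually (eventually_ne_atTop 0)).exists
  exact ⟨n, hn.1.trans hq, hn.2⟩

lemma measure_lowAverages_inter_eq_zero [MeasurableSpace X] {T U : X → X} {μ : Measure X} [IsFiniteMeasure μ]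
    (hT : MeasurePreserving T μ μ) (hU : MeasurePreserving U μ μ) {f : X → ℝ}
    (hf : Measurable f) {C : ℝ} (hC : ∀ x, |f x| ≤ C) {a b : ℝ} (hab : a < b)
    (hTi : T ⁻¹' lowAverages U (fun x => -f x) (-b) = lowAverages U (fun x => -f x) (-b))
    (hUi : U ⁻¹' lowAverages T f a = lowAverages T f a) :
    μ (lowAverages T f a ∩ lowAverages U (fun x => -f x) (-b)) = 0 := by
  have hC' : ∀ x, |-f x| ≤ C := fun x => by rw [abs_neg]; exact hC x
  set E := lowAverages T f a ∩ lowAverages U (fun x => -f x) (-b) with hEdef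
  have hE : MeasurableSet E := (measurableSet_lowAverages hT.measurable hf a).inter
    (measurableSet_lowAverages hU.measurable hf.neg _)
  have h1 := mul_measureReal_le_setIntegral hT (f := fun x => -f x) hf.neg hC' hE (b := -a)
    (by rw [hEdef, Set.preimage_inter, hTi, preimage_lowAverages T hC]) fun x hx => by
      obtain ⟨n, hn, h0⟩ := exists_birkhoffAverage_lt hx.1
      exact ⟨n, by rw [birkhoffAverage_neg_apply]; linarith, h0⟩
  have h2 := mul_measureReal_le_setIntegral hU hf hC hE (b := b)
    (by rw [hEdef, Set.preimage_inter, hUi, preimage_lowAverages U hC']) fun x hx => by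
      obtain ⟨n, hn, h0⟩ := exists_birkhoffAverage_lt hx.2
      rw [birkhoffAverage_neg_apply] at hn
      exact ⟨n, by linarith, h0⟩
  rw [integral_neg] at h1
  have h3 : 0 ≤ μ.real E := measureReal_nonneg
  have h4 : μ.real E = 0 := by nlinarith
  exact (measureReal_eq_zero_iff).1 h4

lemma frequently_lt_mem_lowAverages {T : X → X} {f : X → ℝ} {a q : ℚ} {x : X} (hq : q < a)
    (h : ∃ᶠ n in atTop, birkhoffAverage ℝ T f n x < q) : x ∈ lowAverages T f a :=
  ⟨q, by exact_mod_cast hq, h⟩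

lemma abs_birkhoffAverage_le {T : X → X} {f : X → ℝ} {C : ℝ} (hC : ∀ x, |f x| ≤ C) (n : ℕ)
    (x : X) : |birkhoffAverage ℝ T f n x| ≤ C := by
  have hC0 : 0 ≤ C := (abs_nonneg _).trans (hC x)
  rcases Nat.eq_zero_or_pos n with rfl | hn
  · simpa using hC0
  have hn' : (0 : ℝ) < n := by exact_mod_cast hn
  rw [birkhoffAverage, smul_eq_mul, abs_mul, abs_of_pos (inv_pos.2 hn'), ← div_eq_inv_mul,
    div_le_iff₀ hn', birkhoffSum]
  refine (Finset.abs_sum_le_sum_abs _ _).trans ((Finset.sum_le_sum fun k _ => hC _).trans ?_)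
  simp [mul_comm]

lemma preimage_symm_eq_of_preimage_eq [MeasurableSpace X] (e : X ≃ᵐ X) {E : Set X} (h : e ⁻¹' E = E) :
    e.symm ⁻¹' E = E := by
  ext x
  have : e.symm x ∈ e ⁻¹' E ↔ e.symm x ∈ E := by rw [h]
  simpa using this.symm

/-- The **pointwise ergodic theorem** for an invertible measure-preserving map and a bounded
function: the averages along the forward and the backward orbit have a common limit. -/
theorem ae_exists_tendsto_birkhoffAverage [MeasurableSpace X] {μ : Measure X} [IsFiniteMeasure μ] (e : X ≃ᵐ X)
    (he : MeasurePreserving e μ μ) {f : X → ℝ} (hf : Measurable f) {C : ℝ}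
    (hC : ∀ x, |f x| ≤ C) :
    ∀ᵐ x ∂μ, ∃ c, Tendsto (fun n => birkhoffAverage ℝ e f n x) atTop (𝓝 c) ∧
      Tendsto (fun n => birkhoffAverage ℝ e.symm f n x) atTop (𝓝 c) := by
  have hC' : ∀ x, |-f x| ≤ C := fun x => by rw [abs_neg]; exact hC x
  have hes : MeasurePreserving e.symm μ μ := he.symm e
  have hi : ∀ g : X → ℝ, (∀ x, |g x| ≤ C) → ∀ a,
      (e ⁻¹' lowAverages e g a = lowAverages e g a ∧
        e.symm ⁻¹' lowAverages e g a = lowAverages e g a) ∧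
      (e ⁻¹' lowAverages e.symm g a = lowAverages e.symm g a ∧
        e.symm ⁻¹' lowAverages e.symm g a = lowAverages e.symm g a) := by
    intro g hg a
    have h1 := preimage_lowAverages e hg a
    have h2 := preimage_lowAverages e.symm hg a
    exact ⟨⟨h1, preimage_symm_eq_of_preimage_eq e h1⟩,
      ⟨preimage_symm_eq_of_preimage_eq e.symm h2, h2⟩⟩
  have hae : ∀ᵐ x ∂μ, ∀ a b : ℚ, a < b →
      ¬ ((x ∈ lowAverages e f a ∨ x ∈ lowAverages e.symm f a) ∧
        (x ∈ lowAverages e (fun x => -f x) (-b) ∨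
          x ∈ lowAverages e.symm (fun x => -f x) (-b))) := by
    simp only [ae_all_iff]
    intro a b hab
    have hab' : (a : ℝ) < b := by exact_mod_cast hab
    have h1 := measure_lowAverages_inter_eq_zero he he hf hC hab'
      (hi _ hC' _).1.1 (hi _ hC _).1.1
    have h2 := measure_lowAverages_inter_eq_zero he hes hf hC hab'
      (hi _ hC' _).2.1 (hi _ hC _).1.2
    have h3 := measure_lowAverages_inter_eq_zero hes he hf hC hab'
      (hi _ hC' _).1.2 (hi _ hC _).2.1
    have h4 := measure_lowAverages_inter_eq_zero hes hes hf hC hab'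
      (hi _ hC' _).2.2 (hi _ hC _).2.2
    rw [measure_eq_zero_iff_ae_notMem] at h1 h2 h3 h4
    filter_upwards [h1, h2, h3, h4] with x h1 h2 h3 h4
    rintro ⟨h5 | h5, h6 | h6⟩
    exacts [h1 ⟨h5, h6⟩, h2 ⟨h5, h6⟩, h3 ⟨h5, h6⟩, h4 ⟨h5, h6⟩]
  filter_upwards [hae] with x hx
  set u : ℕ ⊕ ℕ → ℝ := Sum.elim (fun n => birkhoffAverage ℝ e f n x)
    (fun n => birkhoffAverage ℝ e.symm f n x) with hu
  have hub : ∀ p, |u p| ≤ C := by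
    rintro (n | n)
    · exact abs_birkhoffAverage_le hC n x
    · exact abs_birkhoffAverage_le hC n x
  have hup : ∀ a ∈ Set.range ((↑) : ℚ → ℝ), ∀ b ∈ Set.range ((↑) : ℚ → ℝ), a < b →
      ¬ ((∃ᶠ p in (map Sum.inl atTop ⊔ map Sum.inr atTop : Filter (ℕ ⊕ ℕ)), u p < a) ∧
        ∃ᶠ p in (map Sum.inl atTop ⊔ map Sum.inr atTop : Filter (ℕ ⊕ ℕ)), b < u p) := by
    rintro _ ⟨a, rfl⟩ _ ⟨b, rfl⟩ hab ⟨h1, h2⟩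
    have hab' : a < b := by exact_mod_cast hab
    simp only [frequently_sup, frequently_map, hu, Sum.elim_inl, Sum.elim_inr] at h1 h2
    obtain ⟨a', ha, ha'⟩ := exists_between hab'
    obtain ⟨b', hb, hb'⟩ := exists_between ha'
    refine hx a' b' hb ⟨h1.imp (frequently_lt_mem_lowAverages ha)
      (frequently_lt_mem_lowAverages ha), h2.imp ?_ ?_⟩
    all_goals
      intro h
      refine ⟨-b, by push_cast; simpa using hb', h.mono fun n hn => ?_⟩
      rw [birkhoffAverage_neg_apply]
      push_cast
      linarith
  obtain ⟨c, hc⟩ := tendsto_of_no_upcrossings Rat.denseRange_cast hup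
    (isBoundedUnder_of ⟨C, fun p => (abs_le.1 (hub p)).2⟩)
    (isBoundedUnder_of ⟨-C, fun p => (abs_le.1 (hub p)).1⟩)
  rw [tendsto_sup] at hc
  exact ⟨c, tendsto_map'_iff.1 hc.1, tendsto_map'_iff.1 hc.2⟩

/-- Almost every orbit which meets `B` visits `B` with a frequency that does not tend to zero. -/
theorem ae_not_tendsto_zero_of_mem [MeasurableSpace X] {T : X → X} {μ : Measure X} [IsFiniteMeasure μ]
    (hT : MeasurePreserving T μ μ) {B : Set X} (hB : MeasurableSet B) :
    ∀ᵐ x ∂μ, ∀ k, T^[k] x ∈ B →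
      ¬ Tendsto (fun n => birkhoffAverage ℝ T (B.indicator (1 : X → ℝ)) n x) atTop (𝓝 0) := by
  set f : X → ℝ := B.indicator 1 with hfdef
  have hf : Measurable f := measurable_one.indicator hB
  have hC : ∀ x, |f x| ≤ 1 := fun x => by
    by_cases hx : x ∈ B <;> simp [hfdef, hx]
  have hC' : ∀ x, |-f x| ≤ 1 := fun x => by rw [abs_neg]; exact hC x
  have hb : Bornology.IsBounded (Set.range f) :=
    (isBounded_iff_forall_norm_le).2 ⟨1, by rintro _ ⟨x, rfl⟩; exact hC x⟩
  set E : Set X := {x | Tendsto (fun n => birkhoffAverage ℝ T f n x) atTop (𝓝 0)} with hE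
  have hEm : MeasurableSet E :=
    measurableSet_tendsto _ fun n => measurable_birkhoffAverage hT.measurable hf n
  have hTE : T ⁻¹' E = E := by
    ext x
    have ht := tendsto_birkhoffAverage_apply_sub_birkhoffAverage' ℝ hb T x
    constructor
    · intro h
      simpa [hE] using Tendsto.sub h ht
    · intro h
      simpa [hE] using Tendsto.add ht h
  have hint : ∫ x in E, f x ∂μ ≤ 0 := by
    refine le_of_forall_pos_le_add fun ε hε => ?_
    have hδ : 0 < ε / (μ.real E + 1) := by positivity
    have h1 := mul_measureReal_le_setIntegral hT (f := fun x => -f x) hf.neg hC' hEm hTE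
      (b := -(ε / (μ.real E + 1))) fun x hx => by
        obtain ⟨n, hn, h0⟩ := (((tendsto_order.1 hx).2 _ hδ).and (eventually_ne_atTop 0)).exists
        exact ⟨n, by rw [birkhoffAverage_neg_apply]; linarith, h0⟩
    rw [integral_neg] at h1
    have h2 : ε / (μ.real E + 1) * μ.real E ≤ ε := by
      rw [div_mul_eq_mul_div, div_le_iff₀ (by positivity)]
      nlinarith
    linarith
  have hBE : μ (B ∩ E) = 0 := by
    rw [hfdef, integral_indicator hB] at hint
    simp only [Pi.one_apply, integral_const, smul_eq_mul, mul_one, Measure.restrict_restrict hB,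
      measureReal_restrict_apply_univ] at hint
    exact (measureReal_eq_zero_iff).1 (le_antisymm hint measureReal_nonneg)
  rw [ae_all_iff]
  intro k
  have h3 := (hT.iterate k).quasiMeasurePreserving.ae (measure_eq_zero_iff_ae_notMem.1 hBE)
  filter_upwards [h3] with x hx hxB hxE
  have hTk : T^[k] ⁻¹' E = E := by
    clear h3 hx hxB
    induction k with
    | zero => rfl
    | succ k ih => rw [Function.iterate_succ, Set.preimage_comp, ih, hTE]
  exact hx ⟨hxB, show x ∈ T^[k] ⁻¹' E by rw [hTk]; exact hxE⟩

end Birkhoff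

variable {d : ℕ} {Ω : Type*}

section paths

variable [AddAction (Fin d → ℤ) Ω]

lemma walk_vadd (α : Ω → (Fin d → ℤ)) (ω : Ω) (z x : Fin d → ℤ) (n : ℕ) :
    walk α ω (x + z) n = walk α (z +ᵥ ω) x n + z := by
  induction n with
  | zero => rfl
  | succ n ih => simp only [walk, ih, add_vadd]; abel

lemma walk_add (α : Ω → (Fin d → ℤ)) (ω : Ω) (x : Fin d → ℤ) (m n : ℕ) :
    walk α ω x (m + n) = walk α ω (walk α ω x m) n := by
  induction n with
  | zero => rfl
  | succ n ih => rw [← add_assoc, walk, walk, ih]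

lemma IsBiinfinite.walk_eq {α : Ω → (Fin d → ℤ)} {ω : Ω} {γ : ℤ → (Fin d → ℤ)}
    (h : IsBiinfinite α ω γ) (k : ℤ) (n : ℕ) : walk α ω (γ k) n = γ (k + n) := by
  induction n with
  | zero => simp [walk]
  | succ n ih => rw [walk, ih, ← h]; push_cast; rw [add_assoc]

lemma IsBiinfinite.translate {α : Ω → (Fin d → ℤ)} {ω : Ω} {γ : ℤ → (Fin d → ℤ)}
    (h : IsBiinfinite α ω γ) (z : Fin d → ℤ) (m : ℤ) :
    IsBiinfinite α (z +ᵥ ω) (fun k => γ (m + k) - z) := by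
  intro k
  beta_reduce
  rw [← add_assoc, h, vadd_vadd, sub_add_cancel]
  abel

lemma IsBiinfinite.of_translate {α : Ω → (Fin d → ℤ)} {ω : Ω} {γ : ℤ → (Fin d → ℤ)}
    {z : Fin d → ℤ} (h : IsBiinfinite α (z +ᵥ ω) γ) : IsBiinfinite α ω (fun k => γ k + z) := by
  intro k
  beta_reduce
  rw [h, add_vadd]
  abel

lemma IsBiinfinite.vadd_mem {α : Ω → (Fin d → ℤ)} {ω : Ω} {γ : ℤ → (Fin d → ℤ)}
    (h : IsBiinfinite α ω γ) (k : ℤ) : γ k +ᵥ ω ∈ biinfiniteSet α :=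
  ⟨_, h.translate (γ k) k, by simp⟩

lemma exists_isBiinfinite_of_vadd_mem {α : Ω → (Fin d → ℤ)} {ω : Ω} {z : Fin d → ℤ}
    (h : z +ᵥ ω ∈ biinfiniteSet α) : ∃ γ, IsBiinfinite α ω γ ∧ γ 0 = z := by
  obtain ⟨γ, hγ, h0⟩ := h
  exact ⟨_, hγ.of_translate, by simp [h0]⟩

lemma arrowMap_mem {α : Ω → (Fin d → ℤ)} {ω : Ω} (h : ω ∈ biinfiniteSet α) :
    arrowMap α ω ∈ biinfiniteSet α := by
  obtain ⟨γ, hγ, h0⟩ := h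
  have := hγ.vadd_mem 1
  have h1 := hγ 0
  rw [h0, zero_vadd, zero_add, zero_add] at h1
  rwa [h1] at this

lemma exists_predecessor_of_forall_exists_walk {α : Ω → (Fin d → ℤ)} (hA : IsArrowField α)
    {ω : Ω} {z : Fin d → ℤ} (h : ∀ n, ∃ x, walk α ω x n = z) :
    ∃ w, w + α (w +ᵥ ω) = z ∧ ∀ n, ∃ x, walk α ω x n = w := by
  by_contra! hcon
  have hfin : {w | w + α (w +ᵥ ω) = z}.Finite := by
    refine ((Set.finite_range fun i : Fin d => z - Pi.single i 1).union
      (Set.finite_range fun i : Fin d => z + Pi.single i 1)).subset ?_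
    intro w hw
    obtain ⟨i, hi | hi⟩ := hA (w +ᵥ ω)
    · exact Or.inl ⟨i, by beta_reduce; rw [← hi, ← show _ = z from hw, add_sub_cancel_right]⟩
    · refine Or.inr ⟨i, ?_⟩
      have : Pi.single i 1 = -α (w +ᵥ ω) := by rw [hi, neg_neg]
      beta_reduce
      rw [this, ← show _ = z from hw, add_neg_cancel_right]
  have hcon' : ∀ w, ∃ n, w + α (w +ᵥ ω) = z → ∀ x, walk α ω x n ≠ w := fun w => by
    by_cases hw : w + α (w +ᵥ ω) = z
    · obtain ⟨n, hn⟩ := hcon w hw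
      exact ⟨n, fun _ => hn⟩
    · exact ⟨0, fun h => absurd h hw⟩
  choose N hN using hcon'
  obtain ⟨M, hM⟩ := (hfin.image N).bddAbove
  obtain ⟨x, hx⟩ := h (M + 1)
  have hw : walk α ω x M + α (walk α ω x M +ᵥ ω) = z := hx
  have hle : N (walk α ω x M) ≤ M := hM ⟨_, hw, rfl⟩
  refine hN _ hw (walk α ω x (M - N (walk α ω x M))) ?_
  rw [← walk_add, Nat.sub_add_cancel hle]

lemma exists_isBiinfinite_of_predecessors {α : Ω → (Fin d → ℤ)} {ω : Ω}
    (q : ℕ → (Fin d → ℤ)) (hq : ∀ n, q (n + 1) + α (q (n + 1) +ᵥ ω) = q n) :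
    ∃ γ, IsBiinfinite α ω γ ∧ γ 0 = q 0 := by
  refine ⟨fun k => match k with
    | Int.ofNat n => walk α ω (q 0) n
    | Int.negSucc n => q (n + 1), ?_, rfl⟩
  intro k
  match k with
  | Int.ofNat n => rfl
  | Int.negSucc 0 => exact (hq 0).symm
  | Int.negSucc (n + 1) => exact (hq (n + 1)).symm

lemma mem_biinfiniteSet_iff {α : Ω → (Fin d → ℤ)} (hA : IsArrowField α) {ω : Ω} :
    ω ∈ biinfiniteSet α ↔ ∀ n, ∃ x, walk α ω x n = 0 := by
  constructor
  · rintro ⟨γ, hγ, h0⟩ n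
    exact ⟨γ (-n), by rw [hγ.walk_eq, neg_add_cancel, h0]⟩
  · intro h
    choose f hf hf' using fun z : {z // ∀ n, ∃ x, walk α ω x n = z} =>
      exists_predecessor_of_forall_exists_walk hA z.2
    let q : ℕ → {z // ∀ n, ∃ x, walk α ω x n = z} := fun n =>
      (fun z => ⟨f z, hf' z⟩)^[n] ⟨0, h⟩
    refine exists_isBiinfinite_of_predecessors (fun n => (q n).1) fun n => ?_
    have : q (n + 1) = ⟨f (q n), hf' (q n)⟩ := Function.iterate_succ_apply' _ _ _
    rw [this]
    exact hf (q n)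

/-- The configurations whose origin is the endpoint of the arrow `z`, coming from a point on a
bi-infinite trajectory. -/
def entrySet (α : Ω → (Fin d → ℤ)) (z : Fin d → ℤ) : Set Ω :=
  {ω | -z +ᵥ ω ∈ biinfiniteSet α ∧ α (-z +ᵥ ω) = z}

lemma mem_entrySet_arrow {α : Ω → (Fin d → ℤ)} {ω : Ω} (h : ω ∈ biinfiniteSet α) :
    arrowMap α ω ∈ entrySet α (α ω) := by
  simp [entrySet, arrowMap, h]

lemma arrowMap_neg_vadd {α : Ω → (Fin d → ℤ)} {ω : Ω} {z : Fin d → ℤ}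
    (h : ω ∈ entrySet α z) : arrowMap α (-z +ᵥ ω) = ω := by
  rw [arrowMap, h.2, vadd_neg_vadd]

lemma iUnion_entrySet (α : Ω → (Fin d → ℤ)) : ⋃ z, entrySet α z = biinfiniteSet α := by
  ext ω
  rw [Set.mem_iUnion]
  constructor
  · rintro ⟨z, hz⟩
    rw [← arrowMap_neg_vadd hz]
    exact arrowMap_mem hz.1
  · rintro ⟨γ, hγ, h0⟩
    have h1 := hγ (-1)
    rw [neg_add_cancel, h0] at h1
    have h2 : -α (γ (-1) +ᵥ ω) = γ (-1) := neg_eq_of_add_eq_zero_left h1.symm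
    refine ⟨α (γ (-1) +ᵥ ω), ?_, ?_⟩ <;> rw [h2]
    exact hγ.vadd_mem _

/-- The configurations in which every point has at most one predecessor on a bi-infinite
trajectory. -/
def nonMerging (α : Ω → (Fin d → ℤ)) : Set Ω :=
  {ω | ∀ x z w : Fin d → ℤ, x +ᵥ ω ∈ entrySet α z → x +ᵥ ω ∈ entrySet α w → z = w}

lemma vadd_mem_nonMerging {α : Ω → (Fin d → ℤ)} {ω : Ω} (h : ω ∈ nonMerging α)
    (y : Fin d → ℤ) : y +ᵥ ω ∈ nonMerging α := by
  intro x z w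
  rw [vadd_vadd]
  exact h _ z w

/-- The part of `biinfiniteSet α` on which the arrow map is invertible. -/
def biinfiniteCore (α : Ω → (Fin d → ℤ)) : Set Ω := biinfiniteSet α ∩ nonMerging α

lemma arrowMap_mem_core {α : Ω → (Fin d → ℤ)} {ω : Ω} (h : ω ∈ biinfiniteCore α) :
    arrowMap α ω ∈ biinfiniteCore α :=
  ⟨arrowMap_mem h.1, vadd_mem_nonMerging h.2 _⟩

lemma arrowMap_injOn_core (α : Ω → (Fin d → ℤ)) : Set.InjOn (arrowMap α) (biinfiniteCore α) := by
  intro ω h ω' h' heq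
  have h1 := mem_entrySet_arrow h.1
  have h2 := mem_entrySet_arrow h'.1
  rw [← heq] at h2
  have h3 : α ω = α ω' := (arrowMap_mem_core h).2 0 _ _ (by simpa using h1) (by simpa using h2)
  rw [arrowMap, arrowMap, h3] at heq
  exact vadd_left_cancel _ heq

lemma measure_entrySet_inter [MeasurableSpace Ω] {P : Measure Ω}
    [VAddInvariantMeasure (Fin d → ℤ) Ω P] {α : Ω → (Fin d → ℤ)} (z : Fin d → ℤ) (A : Set Ω) :
    P (entrySet α z ∩ A) = P (biinfiniteSet α ∩ α ⁻¹' {z} ∩ (z +ᵥ ·) ⁻¹' A) := by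
  have : entrySet α z ∩ A =
      (-z +ᵥ ·) ⁻¹' (biinfiniteSet α ∩ α ⁻¹' {z} ∩ (z +ᵥ ·) ⁻¹' A) := by
    ext ω
    simp [entrySet]
  rw [this, measure_preimage_vadd]

end paths

section measure

variable [AddAction (Fin d → ℤ) Ω] [MeasurableSpace Ω] [MeasurableConstVAdd (Fin d → ℤ) Ω]

lemma measurable_vadd_self {g : Ω → (Fin d → ℤ)} (hg : Measurable g) :
    Measurable fun ω => g ω +ᵥ ω := by
  have : Measurable fun p : (Fin d → ℤ) × Ω => p.1 +ᵥ p.2 :=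
    measurable_from_prod_countable_right fun z => measurable_const_vadd z
  exact this.comp (hg.prodMk measurable_id)

lemma measurable_arrowMap {α : Ω → (Fin d → ℤ)} (hα : Measurable α) :
    Measurable (arrowMap α) := measurable_vadd_self hα

lemma measurable_walk {α : Ω → (Fin d → ℤ)} (hα : Measurable α) (x : Fin d → ℤ) (n : ℕ) :
    Measurable fun ω => walk α ω x n := by
  induction n with
  | zero => exact measurable_const
  | succ n ih => exact ih.add (hα.comp (measurable_vadd_self ih))

lemma measurableSet_biinfiniteSet {α : Ω → (Fin d → ℤ)} (hα : Measurable α)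
    (hA : IsArrowField α) : MeasurableSet (biinfiniteSet α) := by
  have : biinfiniteSet α = ⋂ n, ⋃ x, {ω | walk α ω x n = 0} := by
    ext ω
    simp [mem_biinfiniteSet_iff hA]
  rw [this]
  exact MeasurableSet.iInter fun n => MeasurableSet.iUnion fun x =>
    measurable_walk hα x n (measurableSet_singleton 0)

lemma measurableSet_entrySet {α : Ω → (Fin d → ℤ)} (hα : Measurable α)
    (hA : IsArrowField α) (z : Fin d → ℤ) : MeasurableSet (entrySet α z) :=
  ((measurableSet_biinfiniteSet hα hA).inter (hα (measurableSet_singleton z))).preimage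
    (measurable_const_vadd (-z))

lemma measurableSet_nonMerging {α : Ω → (Fin d → ℤ)} (hα : Measurable α)
    (hA : IsArrowField α) : MeasurableSet (nonMerging α) := by
  have : nonMerging α = ⋂ x : Fin d → ℤ, ⋂ z, ⋂ w,
      (x +ᵥ ·) ⁻¹' ((entrySet α z)ᶜ ∪ ((entrySet α w)ᶜ ∪ {_ω | z = w})) := by
    ext ω
    simp only [nonMerging, Set.mem_ofPred_eq, Set.mem_iInter, Set.mem_preimage, Set.mem_union,
      Set.mem_compl_iff]
    grind
  rw [this]
  exact MeasurableSet.iInter fun x => MeasurableSet.iInter fun z => MeasurableSet.iInter fun w =>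
    ((measurableSet_entrySet hα hA z).compl.union ((measurableSet_entrySet hα hA w).compl.union
      (MeasurableSet.const _))).preimage (measurable_const_vadd x)

lemma measurableSet_biinfiniteCore {α : Ω → (Fin d → ℤ)} (hα : Measurable α)
    (hA : IsArrowField α) : MeasurableSet (biinfiniteCore α) :=
  (measurableSet_biinfiniteSet hα hA).inter (measurableSet_nonMerging hα hA)

variable {P : Measure Ω} [VAddInvariantMeasure (Fin d → ℤ) Ω P]

lemma ae_forall_vadd {p : Ω → Prop} (h : ∀ᵐ ω ∂P, p ω) :
    ∀ᵐ ω ∂P, ∀ z : Fin d → ℤ, p (z +ᵥ ω) :=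
  ae_all_iff.2 fun z => (measurePreserving_vadd z P).quasiMeasurePreserving.ae h

lemma tsum_measure_entrySet_inter {α : Ω → (Fin d → ℤ)} (hα : Measurable α)
    (hA : IsArrowField α) {A : Set Ω} (hAm : MeasurableSet A) :
    ∑' z, P (entrySet α z ∩ A) = P (biinfiniteSet α ∩ arrowMap α ⁻¹' A) := by
  have : biinfiniteSet α ∩ arrowMap α ⁻¹' A =
      ⋃ z, biinfiniteSet α ∩ α ⁻¹' {z} ∩ (z +ᵥ ·) ⁻¹' A := by
    ext ω
    simp [arrowMap]
  rw [this, measure_iUnion]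
  · exact tsum_congr fun z => measure_entrySet_inter z A
  · intro z w hzw
    refine Set.disjoint_left.2 fun ω h1 h2 => hzw ?_
    exact (show α ω = z from h1.1.2).symm.trans h2.1.2
  · exact fun z => ((measurableSet_biinfiniteSet hα hA).inter
      (hα (measurableSet_singleton z))).inter (hAm.preimage (measurable_const_vadd z))

variable [IsProbabilityMeasure P]

lemma ae_mem_nonMerging {α : Ω → (Fin d → ℤ)} (hα : Measurable α) (hA : IsArrowField α) :
    ∀ᵐ ω ∂P, ω ∈ nonMerging α := by
  have hSm := measurableSet_biinfiniteSet hα hA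
  have hBm := measurableSet_entrySet hα hA
  have hsub : ∀ z, entrySet α z ⊆ biinfiniteSet α := fun z => by
    rw [← iUnion_entrySet]
    exact Set.subset_iUnion _ z
  have h1 : ∫⁻ ω, ∑' z, (entrySet α z).indicator 1 ω ∂P = P (biinfiniteSet α) := by
    rw [lintegral_tsum fun z => (measurable_one.indicator (hBm z)).aemeasurable]
    have := tsum_measure_entrySet_inter (P := P) hα hA MeasurableSet.univ
    simp only [Set.inter_univ, Set.preimage_univ] at this
    rw [← this]
    exact tsum_congr fun z => lintegral_indicator_one (hBm z)
  have h2 : (biinfiniteSet α).indicator 1 ≤ᵐ[P]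
      fun ω => ∑' z, (entrySet α z).indicator (1 : Ω → ENNReal) ω := by
    refine ae_of_all _ fun ω => ?_
    by_cases h : ω ∈ biinfiniteSet α
    · obtain ⟨z, hz⟩ := Set.mem_iUnion.1 ((iUnion_entrySet α).symm ▸ h)
      refine le_trans ?_ (ENNReal.le_tsum z)
      simp [h, hz]
    · simp [h]
  have h3 := ae_eq_of_ae_le_of_lintegral_le h2 (by
    rw [lintegral_indicator_one hSm]; exact measure_ne_top _ _)
    (Measurable.tsum fun z => measurable_one.indicator (hBm z)).aemeasurable
    (by rw [h1, lintegral_indicator_one hSm])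
  refine ae_forall_vadd (p := fun ω => ∀ z w, ω ∈ entrySet α z → ω ∈ entrySet α w → z = w) ?_
  filter_upwards [h3] with ω hω z w hz hw
  by_contra hzw
  have h4 := ENNReal.sum_le_tsum (f := fun z => (entrySet α z).indicator (1 : Ω → ENNReal) ω) {z, w}
  rw [← hω, Finset.sum_pair hzw] at h4
  simp only [Set.indicator_of_mem hz, Set.indicator_of_mem hw,
    Set.indicator_of_mem (hsub z hz), Pi.one_apply] at h4
  norm_num at h4

lemma measurePreserving_arrowMap {α : Ω → (Fin d → ℤ)} (hα : Measurable α)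
    (hA : IsArrowField α) :
    MeasurePreserving (arrowMap α) (P.restrict (biinfiniteSet α))
      (P.restrict (biinfiniteSet α)) := by
  have hTm := measurable_arrowMap hα
  refine ⟨hTm, Measure.ext fun A hAm => ?_⟩
  rw [Measure.map_apply hTm hAm, Measure.restrict_apply (hTm hAm), Measure.restrict_apply hAm,
    Set.inter_comm, ← tsum_measure_entrySet_inter hα hA hAm, ← iUnion_entrySet, Set.inter_comm A,
    Set.iUnion_inter, measure_iUnion₀]
  · intro z w hzw
    refine measure_mono_null ?_ ((measure_eq_zero_iff_ae_notMem
      (s := (nonMerging α)ᶜ)).2 ?_)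
    · intro ω h hω
      exact hzw (hω 0 z w (by simpa using h.1.1) (by simpa using h.2.1))
    · filter_upwards [ae_mem_nonMerging hα hA] with ω hω h
      exact h hω
  · exact fun z => ((measurableSet_entrySet hα hA z).inter hAm).nullMeasurableSet

lemma biinfiniteCore_ae_eq {α : Ω → (Fin d → ℤ)} (hα : Measurable α) (hA : IsArrowField α) :
    biinfiniteCore α =ᵐ[P] biinfiniteSet α := by
  filter_upwards [ae_mem_nonMerging (P := P) hα hA] with ω hω
  exact propext ⟨fun h => h.1, fun h => ⟨h, hω⟩⟩

lemma exists_measurableEquiv_core {α : Ω → (Fin d → ℤ)} (hα : Measurable α)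
    (hA : IsArrowField α) : ∃ e : biinfiniteCore α ≃ᵐ biinfiniteCore α,
      (∀ ω : biinfiniteCore α, (e ω : Ω) = arrowMap α ω) ∧
        MeasurePreserving e (P.comap Subtype.val) (P.comap Subtype.val) := by
  have hCm := measurableSet_biinfiniteCore hα hA
  let f : biinfiniteCore α → biinfiniteCore α := fun ω => ⟨arrowMap α ω, arrowMap_mem_core ω.2⟩
  have hf : Function.Bijective f := by
    constructor
    · intro ω ω' h
      exact Subtype.ext (arrowMap_injOn_core α ω.2 ω'.2 (congrArg Subtype.val h))
    · intro ω
      obtain ⟨z, hz⟩ := Set.mem_iUnion.1 ((iUnion_entrySet α).symm ▸ ω.2.1)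
      exact ⟨⟨-z +ᵥ (ω : Ω), hz.1, vadd_mem_nonMerging ω.2.2 _⟩,
        Subtype.ext (arrowMap_neg_vadd hz)⟩
  have hfm : Measurable f := ((measurable_arrowMap hα).comp measurable_subtype_coe).subtype_mk
  let g := Equiv.ofBijective f hf
  have hg : Measurable g.symm := by
    rintro _ ⟨A, hAm, rfl⟩
    have : g.symm ⁻¹' (Subtype.val ⁻¹' A) =
        Subtype.val ⁻¹' (⋃ z, entrySet α z ∩ (-z +ᵥ ·) ⁻¹' A) := by
      ext ω
      obtain ⟨y, rfl⟩ := g.surjective ω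
      have hgy : ((g y : biinfiniteCore α) : Ω) = arrowMap α y := rfl
      simp only [Set.mem_preimage, Equiv.symm_apply_apply, Set.mem_iUnion, hgy]
      constructor
      · intro hy
        exact ⟨α y, mem_entrySet_arrow y.2.1, by simpa [arrowMap] using hy⟩
      · rintro ⟨z, hz, hzA⟩
        have hy' : -z +ᵥ arrowMap α (y : Ω) ∈ biinfiniteCore α :=
          ⟨hz.1, vadd_mem_nonMerging (arrowMap_mem_core y.2).2 _⟩
        have := arrowMap_injOn_core α hy' y.2 (arrowMap_neg_vadd hz)
        rwa [Set.mem_preimage, this] at hzA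
    rw [this]
    exact measurable_subtype_coe (MeasurableSet.iUnion fun z =>
      (measurableSet_entrySet hα hA z).inter (hAm.preimage (measurable_const_vadd _)))
  refine ⟨⟨g, hfm, hg⟩, fun ω => rfl, hfm, Measure.ext fun B hB => ?_⟩
  obtain ⟨A, hAm, rfl⟩ := hB
  have hval : ∀ A, MeasurableSet A → (P.comap (Subtype.val : biinfiniteCore α → Ω))
      (Subtype.val ⁻¹' A) = P.restrict (biinfiniteSet α) A := fun A hA' => by
    rw [← Measure.map_apply measurable_subtype_coe hA', map_comap_subtype_coe hCm,
      Measure.restrict_congr_set (biinfiniteCore_ae_eq hα hA)]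
  have hT := measurable_arrowMap hα
  change Measure.map f _ _ = _
  rw [Measure.map_apply hfm (measurable_subtype_coe hAm), hval A hAm,
    ← (measurePreserving_arrowMap (P := P) hα hA).measure_preimage hAm.nullMeasurableSet,
    ← hval _ (hT hAm)]
  rfl

theorem isInvertibleSystemOn_biinfiniteSet {α : Ω → (Fin d → ℤ)} (hα : Measurable α)
    (hA : IsArrowField α) : IsInvertibleSystemOn P (biinfiniteSet α) (arrowMap α) :=
  ⟨measurableSet_biinfiniteSet hα hA, fun _ => arrowMap_mem, measurePreserving_arrowMap hα hA,
    biinfiniteCore α, Set.inter_subset_left, measurableSet_biinfiniteCore hα hA,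
    (ae_le_set.1 (biinfiniteCore_ae_eq hα hA).symm.le), exists_measurableEquiv_core hα hA⟩

end measure

lemma tendsto_toLp_iff {ι : Type*} {l : Filter ι} {f : ι → EuclideanSpace ℝ (Fin d)}
    {v : EuclideanSpace ℝ (Fin d)} :
    Tendsto f l (𝓝 v) ↔ ∀ i, Tendsto (fun n => f n i) l (𝓝 (v i)) := by
  rw [← tendsto_pi_nhds]
  constructor
  · intro h
    exact ((PiLp.continuous_ofLp 2 _).tendsto v).comp h
  · intro h
    exact ((PiLp.continuous_toLp 2 _).tendsto _).comp h

lemma hasAsymptoticVelocity_iff {x : ℕ → (Fin d → ℤ)} {v : EuclideanSpace ℝ (Fin d)} :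
    HasAsymptoticVelocity x v ↔ ∀ i, Tendsto (fun n : ℕ => (n : ℝ)⁻¹ * x n i) atTop (𝓝 (v i)) := by
  rw [HasAsymptoticVelocity, tendsto_toLp_iff]
  rfl

lemma HasAsymptoticVelocity.add_const {x : ℕ → (Fin d → ℤ)} {v : EuclideanSpace ℝ (Fin d)}
    (h : HasAsymptoticVelocity x v) (z : Fin d → ℤ) :
    HasAsymptoticVelocity (fun n => x n + z) v := by
  rw [hasAsymptoticVelocity_iff] at h ⊢
  intro i
  have h1 : Tendsto (fun n : ℕ => (n : ℝ)⁻¹ * (z i : ℝ)) atTop (𝓝 (0 * z i)) :=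
    tendsto_inv_atTop_nhds_zero_nat.mul_const _
  have := (h i).add h1
  simpa [mul_add] using this

lemma HasAsymptoticVelocity.unique {x : ℕ → (Fin d → ℤ)} {v w : EuclideanSpace ℝ (Fin d)}
    (h : HasAsymptoticVelocity x v) (h' : HasAsymptoticVelocity x w) : v = w :=
  tendsto_nhds_unique h h'

lemma HasAsymptoticVelocity.shift {x : ℕ → (Fin d → ℤ)} {v : EuclideanSpace ℝ (Fin d)}
    (h : HasAsymptoticVelocity x v) (m : ℕ) :
    HasAsymptoticVelocity (fun n => x (n + m)) v := by
  rw [hasAsymptoticVelocity_iff] at h ⊢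
  intro i
  have h1 := (tendsto_add_atTop_iff_nat m).2 (h i)
  have h2 : Tendsto (fun n : ℕ => ((n : ℝ)⁻¹ * ((n + m : ℕ) : ℝ))) atTop (𝓝 1) := by
    have : Tendsto (fun n : ℕ => 1 + (m : ℝ) * (n : ℝ)⁻¹) atTop (𝓝 (1 + m * 0)) :=
      tendsto_const_nhds.add (tendsto_inv_atTop_nhds_zero_nat.const_mul _)
    rw [mul_zero, add_zero] at this
    refine this.congr' ?_
    filter_upwards [eventually_gt_atTop 0] with n hn
    have : (n : ℝ) ≠ 0 := by positivity
    push_cast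
    field_simp
  have h3 := h2.mul h1
  rw [one_mul] at h3
  refine h3.congr' ?_
  filter_upwards [eventually_gt_atTop 0] with n hn
  have : (n : ℝ) ≠ 0 := by positivity
  have : ((n + m : ℕ) : ℝ) ≠ 0 := by positivity
  field_simp

/-- A nonzero asymptotic velocity gives an asymptotic direction. -/
lemma HasAsymptoticVelocity.hasAsymptoticDirection {x : ℕ → (Fin d → ℤ)}
    {v : EuclideanSpace ℝ (Fin d)} (h : HasAsymptoticVelocity x v) (hv : v ≠ 0) :
    HasAsymptoticDirection x (‖v‖⁻¹ • v) := by
  have hv' : ‖v‖ ≠ 0 := norm_ne_zero_iff.2 hv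
  refine ⟨by rw [norm_smul, norm_inv, norm_norm, inv_mul_cancel₀ hv'], ?_⟩
  have h1 := (h.norm.inv₀ hv').smul h
  refine h1.congr' ?_
  filter_upwards [eventually_gt_atTop 0] with n hn
  have hn' : (0 : ℝ) < n := by positivity
  rw [norm_smul, norm_inv, Real.norm_natCast, mul_inv, inv_inv, smul_smul]
  congr 1
  field_simp

lemma exists_forall_abs_le_of_tendsto_zero {y : ℕ → ℝ}
    (h : Tendsto (fun n : ℕ => (n : ℝ)⁻¹ * y n) atTop (𝓝 0)) {ε : ℝ} (hε : 0 < ε) :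
    ∃ C, ∀ n : ℕ, |y n| ≤ C + ε * n := by
  obtain ⟨N, hN⟩ := (Metric.tendsto_atTop.1 h) ε hε
  refine ⟨∑ k ∈ Finset.range (N + 1), |y k|, fun n => ?_⟩
  have h0 : 0 ≤ ∑ k ∈ Finset.range (N + 1), |y k| := Finset.sum_nonneg fun _ _ => abs_nonneg _
  by_cases hn : n < N + 1
  · have := Finset.single_le_sum (f := fun k => |y k|) (fun _ _ => abs_nonneg _)
      (Finset.mem_range.2 hn)
    have : 0 ≤ ε * n := by positivity
    linarith
  · have hn0 : (0 : ℝ) < n := by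
      have : 0 < n := by lia
      exact_mod_cast this
    have := hN n (by lia)
    rw [Real.dist_0_eq_abs, abs_mul, abs_inv, abs_of_pos hn0, ← div_eq_inv_mul,
      div_lt_iff₀ hn0] at this
    linarith

/-- If an integer sequence is sublinear, then the times whose values do not recur later have
density zero. -/
lemma tendsto_density_of_tendsto_zero {Y : ℕ → ℤ} {D : ℕ → Prop} [DecidablePred D]
    (hD : ∀ j k, D j → j < k → Y k ≠ Y j)
    (h : Tendsto (fun n : ℕ => (n : ℝ)⁻¹ * Y n) atTop (𝓝 0)) :
    Tendsto (fun n : ℕ => (n : ℝ)⁻¹ * ((Finset.range n).filter D).card) atTop (𝓝 0) := by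
  rw [Metric.tendsto_atTop]
  intro ε hε
  obtain ⟨C, hC⟩ := exists_forall_abs_le_of_tendsto_zero h (ε := ε / 4) (by positivity)
  have hcard : ∀ n : ℕ, (((Finset.range n).filter D).card : ℝ) ≤ 2 * (C + ε / 4 * n) + 1 := by
    intro n
    have hC0 : 0 ≤ C := by simpa using (abs_nonneg _).trans (hC 0)
    set m := ⌊C + ε / 4 * n⌋ with hm
    have hm0 : 0 ≤ m := Int.floor_nonneg.2 (by positivity)
    have h1 : ((Finset.range n).filter D).card ≤ (Finset.Icc (-m) m).card := by
      refine Finset.card_le_card_of_injOn Y ?_ ?_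
      · intro j hj
        simp only [Finset.coe_filter, Finset.mem_range, Set.mem_ofPred_eq] at hj
        have h2 : |(Y j : ℝ)| ≤ C + ε / 4 * n := by
          refine (hC j).trans ?_
          have : (j : ℝ) ≤ n := by exact_mod_cast hj.1.le
          gcongr
        have h3 : |Y j| ≤ m := Int.le_floor.2 (by exact_mod_cast h2)
        simpa [abs_le] using h3
      · intro j hj k hk hjk
        simp only [Finset.coe_filter, Finset.mem_range, Set.mem_ofPred_eq] at hj hk
        rcases lt_trichotomy j k with h | h | h
        · exact absurd hjk.symm (hD j k hj.2 h)
        · exact h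
        · exact absurd hjk (hD k j hk.2 h)
    have h4 : ((Finset.Icc (-m) m).card : ℤ) = 2 * m + 1 := by
      rw [Int.card_Icc, Int.toNat_of_nonneg (by lia)]
      ring
    have h5 : (((Finset.range n).filter D).card : ℤ) ≤ 2 * m + 1 := by
      rw [← h4]; exact_mod_cast h1
    have h6 : (((Finset.range n).filter D).card : ℝ) ≤ 2 * (m : ℝ) + 1 := by exact_mod_cast h5
    have h7 : (m : ℝ) ≤ C + ε / 4 * n := Int.floor_le _
    linarith
  obtain ⟨N, hN⟩ := exists_nat_gt ((2 * C + 1) * (2 / ε))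
  refine ⟨N + 1, fun n hn => ?_⟩
  have hn0 : (0 : ℝ) < n := by
    have : 0 < n := by lia
    exact_mod_cast this
  have hn1 : (N : ℝ) < n := by exact_mod_cast hn
  rw [Real.dist_0_eq_abs, abs_of_nonneg (by positivity), ← div_eq_inv_mul, div_lt_iff₀ hn0]
  have h1 := hcard n
  have h2 : (2 * C + 1) * (2 / ε) < n := hN.trans hn1
  rw [← mul_div_assoc, div_lt_iff₀ hε] at h2
  linarith

lemma abs_arrow_apply_le {α : Ω → (Fin d → ℤ)} (hA : IsArrowField α) (ω : Ω) (i : Fin d) :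
    |(α ω i : ℝ)| ≤ 1 := by
  obtain ⟨j, hj | hj⟩ := hA ω <;> rw [hj] <;> by_cases hij : i = j <;>
    simp [hij]

section action

variable [AddAction (Fin d → ℤ) Ω]

lemma walk_eq_add_walk_vadd (α : Ω → (Fin d → ℤ)) (ω : Ω) (x : Fin d → ℤ) (n : ℕ) :
    walk α ω x n = walk α (x +ᵥ ω) 0 n + x := by
  rw [← walk_vadd, zero_add]

lemma iterate_arrowMap (α : Ω → (Fin d → ℤ)) (ω : Ω) (n : ℕ) :
    (arrowMap α)^[n] ω = walk α ω 0 n +ᵥ ω := by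
  induction n with
  | zero => simp [walk]
  | succ n ih => rw [Function.iterate_succ_apply', ih, walk, arrowMap, vadd_vadd, add_comm]

lemma lineCrossing_one_of_isDirected [MeasurableSpace Ω] {P : Measure Ω}
    {α : Ω → (Fin d → ℤ)} (h : IsDirected α) : LineCrossing P α 1 := by
  refine ae_of_all _ fun ω x c => ?_
  have hsum : ∀ n : ℕ, ∑ i, walk α ω x n i = ∑ i, x i + n := by
    intro n
    induction n with
    | zero => simp [walk]
    | succ n ih =>
      obtain ⟨i, hi⟩ := h (walk α ω x n +ᵥ ω)
      simp only [walk, Pi.add_apply, Finset.sum_add_distrib, ih, hi]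
      rw [Finset.sum_pi_single' i 1 Finset.univ]
      simp
      ring
  refine Set.Subsingleton.finite fun m hm n hn => ?_
  simp only [Pi.one_apply, one_mul, hsum, Set.mem_ofPred_eq] at hm hn
  lia

variable {α : Ω → (Fin d → ℤ)} {e : Equiv.Perm (biinfiniteCore α)}

lemma iterate_core_coe (he : ∀ ω, (e ω : Ω) = arrowMap α ω) (ω : biinfiniteCore α) (n : ℕ) :
    ((e^[n] ω : biinfiniteCore α) : Ω) = walk α ω 0 n +ᵥ (ω : Ω) := by
  rw [← iterate_arrowMap]
  induction n with
  | zero => rfl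
  | succ n ih => rw [Function.iterate_succ_apply', Function.iterate_succ_apply', he, ih]

lemma iterate_core_symm_coe (he : ∀ ω, (e ω : Ω) = arrowMap α ω) (ω : biinfiniteCore α)
    {γ : ℤ → (Fin d → ℤ)} (hγ : IsBiinfinite α (ω : Ω) γ) (h0 : γ 0 = 0) (n : ℕ) :
    ((e.symm^[n] ω : biinfiniteCore α) : Ω) = γ (-n) +ᵥ (ω : Ω) := by
  induction n with
  | zero => simp [h0]
  | succ n ih =>
    have hmem : γ (-(n + 1 : ℕ)) +ᵥ (ω : Ω) ∈ biinfiniteCore α :=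
      ⟨hγ.vadd_mem _, vadd_mem_nonMerging ω.2.2 _⟩
    have : e ⟨_, hmem⟩ = e.symm^[n] ω := by
      refine Subtype.ext ?_
      rw [he, ih, arrowMap, vadd_vadd, add_comm, ← hγ]
      congr 2
      push_cast
      ring
    rw [Function.iterate_succ_apply', ← this, Equiv.symm_apply_apply]

lemma birkhoffSum_core (he : ∀ ω, (e ω : Ω) = arrowMap α ω) (ω : biinfiniteCore α) (i : Fin d)
    (n : ℕ) : birkhoffSum e (fun y => (α y i : ℝ)) n ω = walk α ω 0 n i := by
  induction n with
  | zero => simp [walk]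
  | succ n ih =>
    rw [birkhoffSum_succ, ih, iterate_core_coe he, walk]
    simp

lemma birkhoffSum_core_symm (he : ∀ ω, (e ω : Ω) = arrowMap α ω) (ω : biinfiniteCore α)
    {γ : ℤ → (Fin d → ℤ)} (hγ : IsBiinfinite α (ω : Ω) γ) (h0 : γ 0 = 0) (i : Fin d) (n : ℕ) :
    birkhoffSum e.symm (fun y => (α y i : ℝ)) n (e.symm ω) = -γ (-n) i := by
  induction n with
  | zero => simp [h0]
  | succ n ih =>
    rw [birkhoffSum_succ, ih, ← Function.iterate_succ_apply, iterate_core_symm_coe he ω hγ h0]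
    have := congrFun (hγ (-(n + 1 : ℕ))) i
    rw [show (-(n + 1 : ℕ) : ℤ) + 1 = -n by push_cast; ring] at this
    rw [this]
    simp

end action

section measure

variable [AddAction (Fin d → ℤ) Ω] [MeasurableSpace Ω] [MeasurableConstVAdd (Fin d → ℤ) Ω]
variable {P : Measure Ω} [VAddInvariantMeasure (Fin d → ℤ) Ω P]
variable {α : Ω → (Fin d → ℤ)}

lemma ae_forall_core [IsProbabilityMeasure P] {Q : biinfiniteCore α → Prop} (hα : Measurable α) (hA : IsArrowField α)
    (h : ∀ᵐ ω ∂(P.comap Subtype.val), Q ω) :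
    ∀ᵐ ω ∂P, ω ∈ biinfiniteSet α → ∃ hω : ω ∈ biinfiniteCore α, Q ⟨ω, hω⟩ := by
  have h1 : ∀ᵐ ω : biinfiniteCore α ∂(P.comap Subtype.val),
      ∃ hω : (ω : Ω) ∈ biinfiniteCore α, Q ⟨ω, hω⟩ := by
    filter_upwards [h] with ω hω
    exact ⟨ω.2, hω⟩
  have hCm := measurableSet_biinfiniteCore hα hA
  rw [← ae_restrict_iff_subtype hCm (p := fun ω => ∃ hω : ω ∈ biinfiniteCore α, Q ⟨ω, hω⟩),
    ae_restrict_iff' hCm] at h1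
  filter_upwards [h1, ae_mem_nonMerging (P := P) hα hA] with ω h1 h2 h3
  exact h1 ⟨h3, h2⟩

/-- A property of trajectories through the origin which is invariant under translations
holds for all trajectories. -/
lemma ae_forall_isBiinfinite {Q : (ℤ → (Fin d → ℤ)) → Prop}
    (hQ : ∀ γ z, Q γ → Q (fun k => γ k + z))
    (h : ∀ᵐ ω ∂P, ∀ γ, IsBiinfinite α ω γ → γ 0 = 0 → Q γ) :
    ∀ᵐ ω ∂P, ∀ γ, IsBiinfinite α ω γ → Q γ := by
  filter_upwards [ae_forall_vadd (d := d) h] with ω hω γ hγ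
  have h1 := hω (γ 0) _ (hγ.translate (γ 0) 0) (by simp)
  simpa using hQ _ (γ 0) h1

variable [IsProbabilityMeasure P]

/-- Bi-infinite trajectories have asymptotic velocities. -/
theorem ae_exists_velocity (hα : Measurable α) (hA : IsArrowField α) :
    ∀ᵐ ω ∂P, ∀ γ : ℤ → (Fin d → ℤ), IsBiinfinite α ω γ →
      ∃ v : EuclideanSpace ℝ (Fin d), HasAsymptoticVelocity (fun n => γ n) v ∧
        HasAsymptoticVelocity (fun n => γ (-n)) (-v) := by
  refine ae_forall_isBiinfinite (Q := fun γ => ∃ v : EuclideanSpace ℝ (Fin d),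
    HasAsymptoticVelocity (fun n => γ n) v ∧ HasAsymptoticVelocity (fun n => γ (-n)) (-v))
    (fun γ z => fun ⟨v, h1, h2⟩ => ⟨v, h1.add_const z, h2.add_const z⟩) ?_
  obtain ⟨e, he, hmp⟩ := exists_measurableEquiv_core (P := P) hα hA
  have : IsFiniteMeasure (P.comap (Subtype.val : biinfiniteCore α → Ω)) := by
    refine ⟨?_⟩
    rw [comap_subtype_coe_apply (measurableSet_biinfiniteCore hα hA)]
    exact measure_lt_top _ _
  have hb : ∀ i, ∀ᵐ ω ∂(P.comap (Subtype.val : biinfiniteCore α → Ω)), _ := fun i =>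
    ae_exists_tendsto_birkhoffAverage e hmp (f := fun y => (α y i : ℝ)) (C := 1)
      (measurable_from_top.comp ((measurable_pi_apply i).comp (hα.comp measurable_subtype_coe)))
      (fun y => abs_arrow_apply_le hA y i)
  have hb' := ae_forall_core hα hA (ae_all_iff.2 hb)
  filter_upwards [hb'] with ω hω γ hγ h0
  obtain ⟨hωc, hω⟩ := hω ⟨γ, hγ, h0⟩
  choose c hc hc' using hω
  refine ⟨WithLp.toLp 2 c, ?_, ?_⟩
  · rw [hasAsymptoticVelocity_iff]
    intro i
    refine (hc i).congr fun n => ?_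
    have := birkhoffSum_core (e := e.toEquiv) he ⟨ω, hωc⟩ i n
    rw [birkhoffAverage, smul_eq_mul]
    erw [this]
    have h1 := hγ.walk_eq 0 n
    rw [h0, zero_add] at h1
    rw [h1]
  · rw [hasAsymptoticVelocity_iff]
    intro i
    have hbd : Bornology.IsBounded (Set.range fun y : biinfiniteCore α => (α y i : ℝ)) :=
      isBounded_iff_forall_norm_le.2
        ⟨1, by rintro _ ⟨x, rfl⟩; exact abs_arrow_apply_le hA x i⟩
    have h2 := (tendsto_birkhoffAverage_apply_sub_birkhoffAverage' ℝ hbd e.symm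
      ⟨ω, hωc⟩).add (hc' i)
    have h3 := h2.neg
    rw [zero_add] at h3
    refine h3.congr fun n => ?_
    have := birkhoffSum_core_symm (e := e.toEquiv) he ⟨ω, hωc⟩ hγ h0 i n
    rw [sub_add_cancel, birkhoffAverage, smul_eq_mul]
    erw [this]
    ring

/-- Under the line-crossing assumption bi-infinite trajectories have nonzero drift across the
hyperplanes. -/
theorem ae_velocity_ne_zero (hα : Measurable α) (hA : IsArrowField α) {l : Fin d → ℤ}
    (hl : LineCrossing P α l) :
    ∀ᵐ ω ∂P, ∀ γ : ℤ → (Fin d → ℤ), IsBiinfinite α ω γ →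
      ∀ v : EuclideanSpace ℝ (Fin d), HasAsymptoticVelocity (fun n => γ n) v → v ≠ 0 := by
  refine ae_forall_isBiinfinite (Q := fun γ => ∀ v : EuclideanSpace ℝ (Fin d),
    HasAsymptoticVelocity (fun n => γ n) v → v ≠ 0)
    (fun γ z h v h1 => h v (by simpa using h1.add_const (-z))) ?_
  obtain ⟨e, he, hmp⟩ := exists_measurableEquiv_core (P := P) hα hA
  have : IsFiniteMeasure (P.comap (Subtype.val : biinfiniteCore α → Ω)) := by
    refine ⟨?_⟩
    rw [comap_subtype_coe_apply (measurableSet_biinfiniteCore hα hA)]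
    exact measure_lt_top _ _
  set B : Set (biinfiniteCore α) := {y | ∀ k : ℕ, ∑ i, l i * walk α (y : Ω) 0 (k + 1) i ≠ 0}
    with hB
  have hBm : MeasurableSet B := by
    have : B = ⋂ k : ℕ, {y : biinfiniteCore α | ∑ i, l i * walk α (y : Ω) 0 (k + 1) i = 0}ᶜ := by
      ext y
      simp [hB]
    rw [this]
    refine MeasurableSet.iInter fun k => MeasurableSet.compl ?_
    have hm : Measurable fun y : biinfiniteCore α => ∑ i, l i * walk α (y : Ω) 0 (k + 1) i :=
      Finset.measurable_sum _ fun i _ => ((measurable_pi_apply i).comp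
        ((measurable_walk hα 0 (k + 1)).comp measurable_subtype_coe)).const_mul _
    exact hm (measurableSet_singleton 0)
  have hvis := ae_forall_core hα hA (ae_not_tendsto_zero_of_mem hmp hBm)
  filter_upwards [hvis, hl] with ω hω hline γ hγ h0 v hv hv0
  obtain ⟨hωc, hω⟩ := hω ⟨γ, hγ, h0⟩
  set y : biinfiniteCore α := ⟨ω, hωc⟩
  set Y : ℕ → ℤ := fun n => ∑ i, l i * walk α ω 0 n i with hY
  have hit : ∀ n, ((e^[n] y : biinfiniteCore α) : Ω) = walk α ω 0 n +ᵥ ω := fun n =>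
    iterate_core_coe (e := e.toEquiv) he y n
  have hstep : ∀ n k, ∑ i, l i * walk α ((e^[n] y : biinfiniteCore α) : Ω) 0 k i =
      Y (n + k) - Y n := by
    intro n k
    rw [hit, hY, ← Finset.sum_sub_distrib]
    refine Finset.sum_congr rfl fun i _ => ?_
    rw [walk_add, walk_eq_add_walk_vadd α ω (walk α ω 0 n), Pi.add_apply]
    ring
  obtain ⟨N, hN, hmax⟩ := Set.exists_max_image _ id (hline 0 0) ⟨0, by simp [walk]⟩
  refine hω N ?_ ?_
  · intro k hk
    rw [hstep] at hk
    have h1 : Y N = 0 := hN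
    have h2 := hmax (N + (k + 1)) (show Y (N + (k + 1)) = 0 by linarith)
    simp at h2
  · classical
    have hYt : Tendsto (fun n : ℕ => (n : ℝ)⁻¹ * Y n) atTop (𝓝 0) := by
      rw [hasAsymptoticVelocity_iff] at hv
      have h1 : Tendsto (fun n : ℕ => ∑ i, (l i : ℝ) * ((n : ℝ)⁻¹ * γ n i)) atTop
          (𝓝 (∑ i, (l i : ℝ) * v i)) := tendsto_finsetSum _ fun i _ => (hv i).const_mul _
      simp only [hv0, PiLp.zero_apply, mul_zero, Finset.sum_const_zero] at h1
      refine h1.congr fun n => ?_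
      have h2 := hγ.walk_eq 0 n
      rw [h0, zero_add] at h2
      simp only [hY, h2]
      push_cast
      rw [Finset.mul_sum]
      exact Finset.sum_congr rfl fun i _ => by ring
    have h3 := tendsto_density_of_tendsto_zero (D := fun j => e^[j] y ∈ B) (Y := Y)
      (fun j k hj hjk heq => by
        obtain ⟨m, rfl⟩ := Nat.exists_eq_add_of_lt hjk
        refine hj m ?_
        rw [hstep, ← add_assoc, heq, sub_self]) hYt
    refine h3.congr fun n => ?_
    rw [birkhoffAverage, smul_eq_mul, birkhoffSum]
    simp [Set.indicator_apply, Finset.sum_boole]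

end measure

/-- Two points of the planar lattice are neighbours. -/
def Neighbors (u w : ℤ × ℤ) : Prop :=
  (w.1 = u.1 ∧ (w.2 = u.2 + 1 ∨ w.2 + 1 = u.2)) ∨ (w.2 = u.2 ∧ (w.1 = u.1 + 1 ∨ w.1 + 1 = u.1))

lemma Neighbors.symm {u w : ℤ × ℤ} (h : Neighbors u w) : Neighbors w u := by
  unfold Neighbors at *; lia

/-- The signed crossing of the half-line `{a + 1/2} × (b, ∞)` by the step from `u` to `w`. -/
def crossing (p u w : ℤ × ℤ) : ℤ :=
  (if u.1 = p.1 ∧ w.1 = p.1 + 1 ∧ p.2 < u.2 then 1 else 0) -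
    (if w.1 = p.1 ∧ u.1 = p.1 + 1 ∧ p.2 < u.2 then 1 else 0)

lemma crossing_up {p u w : ℤ × ℤ} (h : Neighbors u w) (hu : p ≠ u) (hw : p ≠ w) :
    crossing p u w = crossing (p.1, p.2 - 1) u w := by
  obtain ⟨a, b⟩ := p
  obtain ⟨x, y⟩ := u
  obtain ⟨x', y'⟩ := w
  simp only [Neighbors, crossing, ne_eq, Prod.mk.injEq] at *
  split_ifs <;> lia

lemma crossing_right {a b : ℤ} {u w : ℤ × ℤ} (h : Neighbors u w) (hu : (a + 1, b) ≠ u)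
    (hw : (a + 1, b) ≠ w) :
    crossing (a, b) u w - crossing (a + 1, b) u w =
      (if w.1 = a + 1 ∧ b < w.2 then 1 else 0) - (if u.1 = a + 1 ∧ b < u.2 then 1 else 0) := by
  obtain ⟨x, y⟩ := u
  obtain ⟨x', y'⟩ := w
  simp only [Neighbors, crossing, ne_eq, Prod.mk.injEq] at *
  split_ifs <;> lia

lemma crossing_of_below {p u w : ℤ × ℤ} (h : Neighbors u w) (hu : u.1 = p.1 → p.2 < u.2)
    (hw : w.1 = p.1 → p.2 < w.2) :
    crossing p u w = (if p.1 < w.1 then 1 else 0) - (if p.1 < u.1 then 1 else 0) := by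
  simp only [Neighbors, crossing] at *
  split_ifs <;> lia

lemma crossing_of_above {p u w : ℤ × ℤ} (h : Neighbors u w) (hu : u.1 = p.1 → u.2 ≤ p.2)
    (hw : w.1 = p.1 → w.2 ≤ p.2) : crossing p u w = 0 := by
  simp only [Neighbors, crossing] at *
  split_ifs <;> lia

/-- The number of signed crossings of a finite path. -/
def crossings (σ : ℕ → ℤ × ℤ) (n : ℕ) (p : ℤ × ℤ) : ℤ :=
  ∑ k ∈ Finset.range n, crossing p (σ k) (σ (k + 1))

section path

variable {σ : ℕ → ℤ × ℤ} {n : ℕ}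

lemma crossings_up (hσ : ∀ k, Neighbors (σ k) (σ (k + 1))) {p : ℤ × ℤ} (hp : ∀ k, p ≠ σ k) :
    crossings σ n p = crossings σ n (p.1, p.2 - 1) :=
  Finset.sum_congr rfl fun k _ => crossing_up (hσ k) (hp k) (hp (k + 1))

lemma crossings_right (hσ : ∀ k, Neighbors (σ k) (σ (k + 1))) {a b : ℤ}
    (hp : ∀ k, (a + 1, b) ≠ σ k) (h0 : (σ 0).1 ≠ a + 1)
    (hn : (σ n).1 ≠ a + 1) : crossings σ n (a, b) = crossings σ n (a + 1, b) := by
  rw [← sub_eq_zero, crossings, crossings, ← Finset.sum_sub_distrib,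
    Finset.sum_congr rfl fun k _ => crossing_right (hσ k) (hp k) (hp (k + 1)),
    Finset.sum_range_sub fun k => if (σ k).1 = a + 1 ∧ b < (σ k).2 then (1 : ℤ) else 0]
  simp [h0, hn]

lemma crossings_eq_of_neighbors (hσ : ∀ k, Neighbors (σ k) (σ (k + 1))) {p q : ℤ × ℤ}
    (hpq : Neighbors p q) (hp : ∀ k, p ≠ σ k) (hq : ∀ k, q ≠ σ k) (hp0 : (σ 0).1 ≠ p.1) (hpn : (σ n).1 ≠ p.1) (hq0 : (σ 0).1 ≠ q.1)
    (hqn : (σ n).1 ≠ q.1) : crossings σ n p = crossings σ n q := by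
  obtain ⟨a, b⟩ := p
  obtain ⟨a', b'⟩ := q
  rcases hpq with ⟨h1, h2 | h2⟩ | ⟨h1, h2 | h2⟩ <;> simp only at h1 h2 <;> subst h1
  · subst h2
    simpa using (crossings_up hσ (n := n) hq).symm
  · subst h2
    simpa using crossings_up hσ (n := n) hp
  · subst h2
    exact crossings_right hσ hq hq0 hqn
  · subst h2
    exact (crossings_right hσ hp hp0 hpn).symm

end path

/-- A nearest-neighbour path `X` which avoids a doubly infinite nearest-neighbour path `γ`,
running from the far left to the far right, cannot pass from above `γ` to below `γ`. -/
theorem not_above_and_below {γ : ℤ → ℤ × ℤ} (hγ : ∀ k, Neighbors (γ k) (γ (k + 1)))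
    {X : ℕ → ℤ × ℤ} (hX : ∀ k, Neighbors (X k) (X (k + 1))) (hdis : ∀ i k, X i ≠ γ k)
    (hl : Tendsto (fun n : ℕ => (γ (-n)).1) atTop atBot)
    (hr : Tendsto (fun n : ℕ => (γ n).1) atTop atTop) {i j : ℕ}
    (hi : ∀ k, (γ k).1 = (X i).1 → (γ k).2 ≤ (X i).2)
    (hj : ∀ k, (γ k).1 = (X j).1 → (X j).2 < (γ k).2) : False := by
  set m := max i j
  obtain ⟨R, hR⟩ : ∃ R : ℤ, ∀ k ≤ m, |(X k).1| ≤ R := by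
    obtain ⟨R, hR⟩ := ((Set.finite_Iic m).image fun k => |(X k).1|).bddAbove
    exact ⟨R, fun k hk => hR ⟨k, hk, rfl⟩⟩
  obtain ⟨K, hKl, hKr⟩ := ((hl.eventually (eventually_lt_atBot (-R))).and
    (hr.eventually (eventually_gt_atTop R))).exists
  set σ : ℕ → ℤ × ℤ := fun k => γ (-K + k) with hσdef
  have hσ : ∀ k, Neighbors (σ k) (σ (k + 1)) := fun k => by
    simp only [hσdef]
    push_cast
    rw [← add_assoc]
    exact hγ _
  have hs : σ 0 = γ (-K) := by simp [hσdef]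
  have he : σ (2 * K) = γ K := by
    simp only [hσdef]
    congr 1
    push_cast
    ring
  have hinv : ∀ k ≤ m, crossings σ (2 * K) (X k) = crossings σ (2 * K) (X 0) := by
    intro k hk
    induction k with
    | zero => rfl
    | succ k ih =>
      have h1 := abs_le.1 (hR k (by lia))
      have h2 := abs_le.1 (hR (k + 1) hk)
      rw [← ih (by lia)]
      refine (crossings_eq_of_neighbors hσ (hX k) (fun _ => hdis _ _) (fun _ => hdis _ _)
        ?_ ?_ ?_ ?_).symm <;> first | (rw [hs]; lia) | (rw [he]; lia)
  have h0 : crossings σ (2 * K) (X i) = 0 :=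
    Finset.sum_eq_zero fun k _ => crossing_of_above (hσ k) (hi _) (hi _)
  have h1 : crossings σ (2 * K) (X j) = 1 := by
    rw [crossings, Finset.sum_congr rfl fun k _ => crossing_of_below (hσ k) (hj _) (hj _),
      Finset.sum_range_sub fun k => if (X j).1 < (σ k).1 then (1 : ℤ) else 0, hs, he]
    have := abs_le.1 (hR j (le_max_right _ _))
    rw [if_pos (by lia), if_neg (by lia)]
    rfl
  rw [hinv i (le_max_left _ _)] at h0
  rw [hinv j (le_max_right _ _)] at h1
  lia

/-- The planar path `γ` has velocity `(a, b)` at both ends. -/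
structure HasPlanarVelocity (γ : ℤ → ℤ × ℤ) (a b : ℝ) : Prop where
  fst : Tendsto (fun n : ℕ => (n : ℝ)⁻¹ * (γ n).1) atTop (𝓝 a)
  snd : Tendsto (fun n : ℕ => (n : ℝ)⁻¹ * (γ n).2) atTop (𝓝 b)
  fst_neg : Tendsto (fun n : ℕ => (n : ℝ)⁻¹ * (γ (-n)).1) atTop (𝓝 (-a))
  snd_neg : Tendsto (fun n : ℕ => (n : ℝ)⁻¹ * (γ (-n)).2) atTop (𝓝 (-b))

lemma HasPlanarVelocity.reverse {γ : ℤ → ℤ × ℤ} {a b : ℝ} (h : HasPlanarVelocity γ a b) :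
    HasPlanarVelocity (fun k => γ (-k)) (-a) (-b) :=
  ⟨h.fst_neg, h.snd_neg, by simpa using h.fst, by simpa using h.snd⟩

lemma neighbors_reverse {γ : ℤ → ℤ × ℤ} (h : ∀ k, Neighbors (γ k) (γ (k + 1))) (k : ℤ) :
    Neighbors (γ (-k)) (γ (-(k + 1))) := by
  have := (h (-(k + 1))).symm
  rwa [show -(k + 1) + 1 = -k by ring] at this

lemma exists_abs_sub_slope_mul_le {x y : ℕ → ℝ} {a b : ℝ} (ha : a ≠ 0)
    (hx : Tendsto (fun n : ℕ => (n : ℝ)⁻¹ * x n) atTop (𝓝 a))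
    (hy : Tendsto (fun n : ℕ => (n : ℝ)⁻¹ * y n) atTop (𝓝 b)) {ε : ℝ} (hε : 0 < ε) :
    ∃ C, ∀ n, |y n - b / a * x n| ≤ C + ε * |x n| := by
  have h1 : Tendsto (fun n : ℕ => (n : ℝ)⁻¹ * (y n - b / a * x n)) atTop (𝓝 0) := by
    have := hy.sub (hx.const_mul (b / a))
    rw [div_mul_cancel₀ b ha, sub_self] at this
    exact this.congr fun n => by ring
  have h2 : Tendsto (fun n : ℕ => (n : ℝ)⁻¹ * (x n - a * n)) atTop (𝓝 0) := by
    have := hx.sub_const a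
    rw [sub_self] at this
    refine this.congr' ?_
    filter_upwards [eventually_gt_atTop 0] with n hn
    have : (n : ℝ) ≠ 0 := by positivity
    field_simp
  have ha' : 0 < |a| := abs_pos.2 ha
  obtain ⟨C₁, hC₁⟩ := exists_forall_abs_le_of_tendsto_zero h1 (ε := ε * |a| / 2) (by positivity)
  obtain ⟨C₂, hC₂⟩ := exists_forall_abs_le_of_tendsto_zero h2 (ε := |a| / 2) (by positivity)
  refine ⟨C₁ + ε * C₂, fun n => (hC₁ n).trans ?_⟩
  have h3 : |a| * n ≤ |x n| + |x n - a * n| := by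
    have h4 : |a * n| = |a| * n := by rw [abs_mul, Nat.abs_cast]
    have h5 := abs_sub (x n) (x n - a * n)
    rw [sub_sub_cancel, h4] at h5
    exact h5
  have h6 : |a| / 2 * n ≤ |x n| + C₂ := by linarith [hC₂ n]
  have h7 := mul_le_mul_of_nonneg_left h6 hε.le
  linarith

lemma HasPlanarVelocity.exists_abs_sub_slope_mul_le {γ : ℤ → ℤ × ℤ} {a b : ℝ}
    (h : HasPlanarVelocity γ a b) (ha : a ≠ 0) {ε : ℝ} (hε : 0 < ε) :
    ∃ C, ∀ k, |((γ k).2 : ℝ) - b / a * (γ k).1| ≤ C + ε * |((γ k).1 : ℝ)| := by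
  obtain ⟨C₁, h₁⟩ := ArrowWalk.exists_abs_sub_slope_mul_le ha h.fst h.snd hε
  obtain ⟨C₂, h₂⟩ := ArrowWalk.exists_abs_sub_slope_mul_le (neg_ne_zero.2 ha) h.fst_neg h.snd_neg hε
  refine ⟨max C₁ C₂, fun k => ?_⟩
  obtain ⟨n, rfl | rfl⟩ := k.eq_nat_or_neg
  · exact (h₁ n).trans (by gcongr; exact le_max_left _ _)
  · have := h₂ n
    rw [neg_div_neg_eq] at this
    exact this.trans (by gcongr; exact le_max_right _ _)

lemma tendsto_atTop_of_tendsto_inv_mul {x : ℕ → ℤ} {a : ℝ} (ha : 0 < a)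
    (hx : Tendsto (fun n : ℕ => (n : ℝ)⁻¹ * x n) atTop (𝓝 a)) : Tendsto x atTop atTop := by
  rw [← tendsto_intCast_atTop_iff (R := ℝ)]
  refine (hx.pos_mul_atTop ha tendsto_natCast_atTop_atTop).congr' ?_
  filter_upwards [eventually_gt_atTop 0] with n hn
  have : (n : ℝ) ≠ 0 := by positivity
  field_simp

/-- A path avoiding a doubly infinite path with non-vertical velocity stays on one side of it. -/
theorem HasPlanarVelocity.not_above_and_below {γ : ℤ → ℤ × ℤ} {a b : ℝ}
    (h : HasPlanarVelocity γ a b) (ha : a ≠ 0) (hγ : ∀ k, Neighbors (γ k) (γ (k + 1)))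
    {X : ℕ → ℤ × ℤ} (hX : ∀ k, Neighbors (X k) (X (k + 1))) (hdis : ∀ i k, X i ≠ γ k) {i j : ℕ}
    (hi : ∀ k, (γ k).1 = (X i).1 → (γ k).2 ≤ (X i).2)
    (hj : ∀ k, (γ k).1 = (X j).1 → (X j).2 < (γ k).2) : False := by
  wlog hpos : 0 < a generalizing γ a b
  · exact this h.reverse (neg_ne_zero.2 ha) (neighbors_reverse hγ) (fun i k => hdis i _)
      (fun k => hi _) (fun k => hj _)
      (neg_pos.2 (lt_of_le_of_ne (not_lt.1 hpos) ha))
  refine ArrowWalk.not_above_and_below hγ hX hdis ?_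
    (tendsto_atTop_of_tendsto_inv_mul hpos h.fst) hi hj
  refine tendsto_neg_atTop_iff.1 (tendsto_atTop_of_tendsto_inv_mul hpos ?_)
  have := h.fst_neg.neg
  rw [neg_neg] at this
  refine this.congr fun n => ?_
  push_cast
  ring

lemma above_and_below_of_envelope {γ : ℤ → ℤ × ℤ} {s C ε : ℝ}
    (h : ∀ k, |((γ k).2 : ℝ) - s * (γ k).1| ≤ C + ε * |((γ k).1 : ℝ)|) (p : ℤ × ℤ) :
    (C + ε * |(p.1 : ℝ)| < (p.2 : ℝ) - s * p.1 → ∀ k, (γ k).1 = p.1 → (γ k).2 ≤ p.2) ∧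
    ((p.2 : ℝ) - s * p.1 < -(C + ε * |(p.1 : ℝ)|) → ∀ k, (γ k).1 = p.1 → p.2 < (γ k).2) := by
  constructor
  all_goals
    intro hp k hk
    have h1 := abs_le.1 (h k)
    rw [hk] at h1
    have h2 : ((γ k).2 : ℝ) < p.2 ∨ (p.2 : ℝ) < (γ k).2 := by
      first | exact Or.inl (by linarith [h1.2]) | exact Or.inr (by linarith [h1.1])
    norm_cast at h2
    first
    | exact (h2.resolve_right fun h3 => by
        have : (p.2 : ℝ) < (γ k).2 := by exact_mod_cast h3
        linarith [h1.2]).le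
    | exact (h2.resolve_left fun h3 => by
        have : ((γ k).2 : ℝ) < p.2 := by exact_mod_cast h3
        linarith [h1.1])

/-- Disjoint doubly infinite paths in the plane have parallel velocities. -/
theorem HasPlanarVelocity.eq_mul_of_disjoint {γ γ' : ℤ → ℤ × ℤ} {a b a' b' : ℝ}
    (h : HasPlanarVelocity γ a b) (h' : HasPlanarVelocity γ' a' b') (ha : a ≠ 0)
    (hγ : ∀ k, Neighbors (γ k) (γ (k + 1))) (hγ' : ∀ k, Neighbors (γ' k) (γ' (k + 1)))
    (hdis : ∀ k l, γ' k ≠ γ l) : b' = b / a * a' := by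
  by_contra hne
  wlog hpos : 0 < b' - b / a * a' generalizing γ' a' b'
  · refine this h'.reverse (neighbors_reverse hγ') (fun k l => hdis _ _)
      (fun h => hne (by linarith)) ?_
    have : b' - b / a * a' ≠ 0 := sub_ne_zero.2 hne
    have := lt_of_le_of_ne (not_lt.1 hpos) this
    linarith
  set s := b / a
  set δ := b' - s * a'
  have hden : 0 < |a'| + 1 := by positivity
  obtain ⟨C, hC⟩ := h.exists_abs_sub_slope_mul_le ha (ε := δ / (|a'| + 1)) (by positivity)
  have hlt : δ / (|a'| + 1) * |a'| < δ := by
    rw [div_mul_eq_mul_div, div_lt_iff₀ hden]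
    linarith
  have hbound : ∀ {x : ℕ → ℝ} {c : ℝ}, |c| = |a'| →
      Tendsto (fun n : ℕ => (n : ℝ)⁻¹ * x n) atTop (𝓝 c) →
      Tendsto (fun n : ℕ => (n : ℝ)⁻¹ * (C + δ / (|a'| + 1) * |x n|)) atTop
        (𝓝 (δ / (|a'| + 1) * |a'|)) := by
    intro x c hc hx
    have h1 := (tendsto_inv_atTop_nhds_zero_nat (𝕜 := ℝ)).mul_const C
    have h2 := h1.add (hx.abs.const_mul (δ / (|a'| + 1)))
    rw [zero_mul, zero_add, hc] at h2
    refine h2.congr fun n => ?_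
    rw [abs_mul, abs_inv, Nat.abs_cast]
    ring
  have hup : ∀ᶠ n : ℕ in atTop, C + δ / (|a'| + 1) * |((γ' n).1 : ℝ)| <
      (γ' n).2 - s * (γ' n).1 := by
    have h1 := h'.snd.sub (h'.fst.const_mul s)
    filter_upwards [(hbound rfl h'.fst).eventually_lt h1 hlt, eventually_gt_atTop 0] with n hn h0
    have h0' : (0 : ℝ) < (n : ℝ)⁻¹ := by positivity
    have : (n : ℝ)⁻¹ * (γ' n).2 - s * ((n : ℝ)⁻¹ * (γ' n).1) =
      (n : ℝ)⁻¹ * ((γ' n).2 - s * (γ' n).1) := by ring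
    rw [this] at hn
    exact lt_of_mul_lt_mul_left hn h0'.le
  have hdown : ∀ᶠ n : ℕ in atTop, ((γ' (-n)).2 : ℝ) - s * (γ' (-n)).1 <
      -(C + δ / (|a'| + 1) * |((γ' (-n)).1 : ℝ)|) := by
    have h1 := (h'.fst_neg.const_mul s).sub h'.snd_neg
    have h2 : s * -a' - -b' = δ := by simp only [δ]; ring
    rw [h2] at h1
    filter_upwards [(hbound (abs_neg _) h'.fst_neg).eventually_lt h1 hlt,
      eventually_gt_atTop 0] with n hn h0
    have h0' : (0 : ℝ) < (n : ℝ)⁻¹ := by positivity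
    have : s * ((n : ℝ)⁻¹ * (γ' (-n)).1) - (n : ℝ)⁻¹ * (γ' (-n)).2 =
      (n : ℝ)⁻¹ * -((γ' (-n)).2 - s * (γ' (-n)).1) := by ring
    rw [this] at hn
    linarith [lt_of_mul_lt_mul_left hn h0'.le]
  obtain ⟨n, hn, hn'⟩ := (hup.and hdown).exists
  refine h.not_above_and_below ha hγ (X := fun k => γ' (-n + k)) (i := 2 * n) (j := 0)
    (fun k => ?_) (fun _ _ => hdis _ _) ?_ ?_
  · push_cast
    rw [← add_assoc]
    exact hγ' _
  · have : (-n + (2 * n : ℕ) : ℤ) = n := by push_cast; ring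
    simp only [this]
    exact (above_and_below_of_envelope hC _).1 hn
  · simp only [Nat.cast_zero, add_zero]
    exact (above_and_below_of_envelope hC _).2 hn'

/-- A path enclosed between two doubly infinite paths of the same slope stays close to a
line of this slope. -/
theorem exists_abs_sub_slope_mul_le_of_between {γ γ' : ℤ → ℤ × ℤ} {a b a' b' s : ℝ}
    (h : HasPlanarVelocity γ a b) (h' : HasPlanarVelocity γ' a' b') (ha : a ≠ 0) (ha' : a' ≠ 0)
    (hs : b / a = s) (hs' : b' / a' = s)
    (hγ : ∀ k, Neighbors (γ k) (γ (k + 1))) (hγ' : ∀ k, Neighbors (γ' k) (γ' (k + 1)))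
    {X : ℕ → ℤ × ℤ} (hX : ∀ k, Neighbors (X k) (X (k + 1)))
    (hdis : ∀ i k, X i ≠ γ k) (hdis' : ∀ i k, X i ≠ γ' k)
    (habove : ∀ k, (γ k).1 = (X 0).1 → (γ k).2 ≤ (X 0).2)
    (hbelow : ∀ k, (γ' k).1 = (X 0).1 → (X 0).2 < (γ' k).2) {ε : ℝ} (hε : 0 < ε) :
    ∃ C, ∀ n, |((X n).2 : ℝ) - s * (X n).1| ≤ C + ε * |((X n).1 : ℝ)| := by
  obtain ⟨C, hC⟩ := h.exists_abs_sub_slope_mul_le ha hε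
  obtain ⟨C', hC'⟩ := h'.exists_abs_sub_slope_mul_le ha' hε
  rw [hs] at hC
  rw [hs'] at hC'
  refine ⟨max C C', fun n => abs_le.2 ⟨?_, ?_⟩⟩
  · by_contra! hlt
    refine h.not_above_and_below ha hγ hX hdis habove
      ((above_and_below_of_envelope hC (X n)).2 ?_)
    linarith [le_max_left C C']
  · by_contra! hlt
    refine h'.not_above_and_below ha' hγ' hX hdis'
      ((above_and_below_of_envelope hC' (X n)).1 ?_) hbelow
    linarith [le_max_right C C']

/-- A transient planar path which stays close to a line of slope `s` goes to infinity along one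
of the two ends of that line. -/
theorem tendsto_slope_of_transient {X : ℕ → ℤ × ℤ} (hX : ∀ k, Neighbors (X k) (X (k + 1)))
    (htr : ∀ p, {n | X n = p}.Finite) {s : ℝ}
    (h : ∀ ε : ℝ, 0 < ε → ∃ C, ∀ n, |((X n).2 : ℝ) - s * (X n).1| ≤ C + ε * |((X n).1 : ℝ)|) :
    ((∀ᶠ n in atTop, 0 < (X n).1) ∨ (∀ᶠ n in atTop, (X n).1 < 0)) ∧
      Tendsto (fun n => ((X n).1 : ℝ)⁻¹ * (X n).2) atTop (𝓝 s) := by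
  have habs : ∀ R : ℤ, ∀ᶠ n in atTop, R < |(X n).1| := by
    intro R
    obtain ⟨C, hC⟩ := h 1 one_pos
    rw [← Nat.cofinite_eq_atTop, eventually_cofinite]
    set M : ℤ := ⌈C + R + |s| * R⌉
    refine (((Finset.Icc (-R) R ×ˢ Finset.Icc (-M) M).finite_toSet).biUnion
      fun p _ => htr p).subset ?_
    intro n hn
    have hn' : |(X n).1| ≤ R := not_lt.1 hn
    have hnR : |((X n).1 : ℝ)| ≤ R := by exact_mod_cast hn'
    have h2 : |((X n).2 : ℝ)| ≤ M := by
      refine le_trans ?_ (Int.le_ceil _)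
      have h3 := hC n
      have h4 : |((X n).2 : ℝ)| ≤ |((X n).2 : ℝ) - s * (X n).1| + |s * (X n).1| := by
        have := abs_add_le (((X n).2 : ℝ) - s * (X n).1) (s * (X n).1)
        rwa [sub_add_cancel] at this
      have h5 : |s * (X n).1| ≤ |s| * R := by
        rw [abs_mul]
        gcongr
      linarith
    have h2' : |(X n).2| ≤ M := by exact_mod_cast h2
    simp only [Set.mem_iUnion]
    refine ⟨X n, ?_, rfl⟩
    simp only [Finset.coe_product, Set.mem_prod, Finset.coe_Icc, Set.mem_Icc]
    exact ⟨abs_le.1 hn', abs_le.1 h2'⟩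
  constructor
  · obtain ⟨N, hN⟩ := eventually_atTop.1 (habs 0)
    have hstep : ∀ n ≥ N, (0 < (X n).1 ↔ 0 < (X N).1) := by
      intro n hn
      induction n, hn using Nat.le_induction with
      | base => rfl
      | succ n hn ih =>
        rw [← ih]
        have h1 := abs_pos.1 (hN n hn)
        have h2 := abs_pos.1 (hN (n + 1) (by lia))
        have h3 := hX n
        unfold Neighbors at h3
        lia
    by_cases h0 : 0 < (X N).1
    · exact Or.inl (eventually_atTop.2 ⟨N, fun n hn => (hstep n hn).2 h0⟩)
    · refine Or.inr (eventually_atTop.2 ⟨N, fun n hn => ?_⟩)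
      have h1 := (hstep n hn).not.2 h0
      have h2 := abs_pos.1 (hN n hn)
      lia
  · rw [Metric.tendsto_atTop']
    intro ε hε
    obtain ⟨C, hC⟩ := h (ε / 2) (by positivity)
    obtain ⟨N, hN⟩ := eventually_atTop.1 ((habs 0).and (habs ⌈C * (2 / ε)⌉))
    refine ⟨N, fun n hn => ?_⟩
    obtain ⟨h0, h1⟩ := hN n hn.le
    have h0' : (0 : ℝ) < |((X n).1 : ℝ)| := by exact_mod_cast h0
    have h1' : C * (2 / ε) < |((X n).1 : ℝ)| := by
      refine lt_of_le_of_lt (Int.le_ceil _) ?_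
      exact_mod_cast h1
    rw [← mul_div_assoc, div_lt_iff₀ hε] at h1'
    have h2 : ((X n).1 : ℝ)⁻¹ * (X n).2 - s = ((X n).1 : ℝ)⁻¹ * ((X n).2 - s * (X n).1) := by
      have : ((X n).1 : ℝ) ≠ 0 := abs_pos.1 h0'
      field_simp
    rw [Real.dist_eq, h2, abs_mul, abs_inv, ← div_eq_inv_mul, div_lt_iff₀ h0']
    linarith [hC n]

section normalize

variable {E : Type*} [NormedAddCommGroup E] [NormedSpace ℝ E]

lemma inv_norm_smul_of_pos {t : ℝ} (ht : 0 < t) (y : E) :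
    ‖t • y‖⁻¹ • (t • y) = ‖y‖⁻¹ • y := by
  rw [norm_smul, Real.norm_of_nonneg ht.le, mul_inv, smul_smul]
  congr 1
  field_simp

lemma inv_norm_smul_of_neg {t : ℝ} (ht : t < 0) (y : E) :
    ‖t • y‖⁻¹ • (t • y) = -(‖y‖⁻¹ • y) := by
  have := inv_norm_smul_of_pos (neg_pos.2 ht) y
  rw [neg_smul, norm_neg, smul_neg] at this
  rw [← this, neg_neg]

lemma norm_inv_norm_smul {y : E} (hy : y ≠ 0) : ‖‖y‖⁻¹ • y‖ = 1 := by
  rw [norm_smul, norm_inv, norm_norm, inv_mul_cancel₀ (norm_ne_zero_iff.2 hy)]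

end normalize

section plane

lemma eq_smul_of_apply_eq {v w : EuclideanSpace ℝ (Fin 2)} {i j : Fin 2} (hij : i ≠ j)
    (hv : v i ≠ 0) (h : w j = v j / v i * w i) : w = (w i / v i) • v := by
  ext k
  have hk : k = i ∨ k = j := by lia
  rcases hk with rfl | rfl
  · simp [hv]
  · rw [h]
    simp only [PiLp.smul_apply, smul_eq_mul]
    ring

/-- A planar sequence with one-signed abscissa and converging slopes has an asymptotic
direction. -/
lemma hasAsymptoticDirection_of_slope {x : ℕ → (Fin 2 → ℤ)} {i j : Fin 2} (hij : i ≠ j)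
    {v : EuclideanSpace ℝ (Fin 2)} (hv : v i ≠ 0)
    (hsign : (∀ᶠ n in atTop, 0 < x n i) ∨ (∀ᶠ n in atTop, x n i < 0))
    (hslope : Tendsto (fun n => (x n i : ℝ)⁻¹ * x n j) atTop (𝓝 (v j / v i))) :
    HasAsymptoticDirection x (‖v‖⁻¹ • v) ∨ HasAsymptoticDirection x (-(‖v‖⁻¹ • v)) := by
  have hv0 : v ≠ 0 := fun h => hv (by simp [h])
  have hr0 : (v i)⁻¹ • v ≠ 0 := smul_ne_zero (inv_ne_zero hv) hv0
  have hne : ∀ᶠ n in atTop, (x n i : ℝ) ≠ 0 := by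
    rcases hsign with h | h <;> filter_upwards [h] with n hn
    · exact_mod_cast hn.ne'
    · exact_mod_cast hn.ne
  have hp : Tendsto (fun n => (x n i : ℝ)⁻¹ • toEuc (x n)) atTop (𝓝 ((v i)⁻¹ • v)) := by
    rw [tendsto_toLp_iff]
    intro k
    have hk : k = i ∨ k = j := by lia
    rcases hk with rfl | rfl
    · have : ((v k)⁻¹ • v) k = 1 := by simp [hv]
      rw [this]
      refine tendsto_const_nhds.congr' ?_
      filter_upwards [hne] with n hn
      simp [toEuc, hn]
    · have : ((v i)⁻¹ • v) k = v k / v i := by simp [div_eq_inv_mul]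
      rw [this]
      exact hslope
  have hN := (hp.norm.inv₀ (norm_ne_zero_iff.2 hr0)).smul hp
  have hdir : ∀ u, ‖u‖ = 1 → Tendsto (fun n => ‖toEuc (x n)‖⁻¹ • toEuc (x n)) atTop (𝓝 u) →
      (u = ‖v‖⁻¹ • v ∨ u = -(‖v‖⁻¹ • v)) →
      HasAsymptoticDirection x (‖v‖⁻¹ • v) ∨ HasAsymptoticDirection x (-(‖v‖⁻¹ • v)) := by
    rintro u hu h (rfl | rfl)
    exacts [Or.inl ⟨hu, h⟩, Or.inr ⟨hu, h⟩]
  have hr : ‖(v i)⁻¹ • v‖⁻¹ • ((v i)⁻¹ • v) = ‖v‖⁻¹ • v ∨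
      ‖(v i)⁻¹ • v‖⁻¹ • ((v i)⁻¹ • v) = -(‖v‖⁻¹ • v) := by
    rcases lt_or_gt_of_ne hv with h | h
    · exact Or.inr (inv_norm_smul_of_neg (inv_lt_zero.2 h) v)
    · exact Or.inl (inv_norm_smul_of_pos (inv_pos.2 h) v)
  rcases hsign with h | h
  · refine hdir _ (norm_inv_norm_smul hr0) (hN.congr' ?_) hr
    filter_upwards [h] with n hn
    exact inv_norm_smul_of_pos (inv_pos.2 (by exact_mod_cast hn)) _
  · refine hdir (-(‖(v i)⁻¹ • v‖⁻¹ • ((v i)⁻¹ • v)))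
      (by rw [norm_neg, norm_inv_norm_smul hr0]) (hN.neg.congr' ?_) ?_
    · filter_upwards [h] with n hn
      rw [inv_norm_smul_of_neg (inv_lt_zero.2 (by exact_mod_cast hn)), neg_neg]
    · rcases hr with hr | hr <;> simp [hr]

lemma HasAsymptoticDirection.shift_iff {d : ℕ} {x : ℕ → (Fin d → ℤ)}
    {u : EuclideanSpace ℝ (Fin d)} (m : ℕ) :
    HasAsymptoticDirection (fun n => x (n + m)) u ↔ HasAsymptoticDirection x u :=
  and_congr_right fun _ => tendsto_add_atTop_iff_nat
    (f := fun n => ‖toEuc (x n)‖⁻¹ • toEuc (x n)) m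

/-- The pair of coordinates `i` and `j`. -/
def coords (i j : Fin 2) (x : Fin 2 → ℤ) : ℤ × ℤ := (x i, x j)

lemma coords_injective {i j : Fin 2} (hij : i ≠ j) : Function.Injective (coords i j) := by
  intro x y h
  simp only [coords, Prod.mk.injEq] at h
  ext k
  have hk : k = i ∨ k = j := by lia
  rcases hk with rfl | rfl
  exacts [h.1, h.2]

lemma neighbors_coords {Ω : Type*} {α : Ω → (Fin 2 → ℤ)} (hA : IsArrowField α) {i j : Fin 2}
    (hij : i ≠ j) (x : Fin 2 → ℤ) (ω : Ω) :
    Neighbors (coords i j x) (coords i j (x + α ω)) := by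
  obtain ⟨k, hk⟩ := hA ω
  have hk' : k = i ∨ k = j := by lia
  rcases hk' with rfl | rfl <;> rcases hk with hk | hk <;>
    simp [Neighbors, coords, hk, hij, hij.symm]

lemma hasPlanarVelocity_coords {γ : ℤ → (Fin 2 → ℤ)} {v : EuclideanSpace ℝ (Fin 2)}
    (h : HasAsymptoticVelocity (fun n => γ n) v) (h' : HasAsymptoticVelocity (fun n => γ (-n)) (-v))
    (i j : Fin 2) : HasPlanarVelocity (fun k => coords i j (γ k)) (v i) (v j) := by
  rw [hasAsymptoticVelocity_iff] at h h'
  exact ⟨h i, h j, h' i, h' j⟩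

end plane

section meeting

variable {d : ℕ} {Ω : Type*} [AddAction (Fin d → ℤ) Ω] {α : Ω → (Fin d → ℤ)} {ω : Ω}

lemma IsBiinfinite.velocity_eq_of_meet {γ γ' : ℤ → (Fin d → ℤ)} (h : IsBiinfinite α ω γ)
    (h' : IsBiinfinite α ω γ') {k l : ℤ} (hkl : γ k = γ' l) {v v' : EuclideanSpace ℝ (Fin d)}
    (hv : HasAsymptoticVelocity (fun n => γ n) v)
    (hv' : HasAsymptoticVelocity (fun n => γ' n) v') : v = v' := by
  have h1 := hv.shift (k + l.natAbs + k.natAbs).toNat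
  have h2 := hv'.shift (l + l.natAbs + k.natAbs).toNat
  refine h1.unique ?_
  convert h2 using 2 with n
  have e1 : ((n + (k + l.natAbs + k.natAbs).toNat : ℕ) : ℤ) =
    k + (l.natAbs + k.natAbs + n : ℕ) := by lia
  have e2 : ((n + (l + l.natAbs + k.natAbs).toNat : ℕ) : ℤ) =
    l + (l.natAbs + k.natAbs + n : ℕ) := by lia
  rw [e1, e2, ← h.walk_eq, ← h'.walk_eq, hkl]

lemma IsBiinfinite.hasAsymptoticDirection_walk_of_meet {γ : ℤ → (Fin d → ℤ)}
    (h : IsBiinfinite α ω γ) {x : Fin d → ℤ} {n : ℕ} {k : ℤ} (hnk : walk α ω x n = γ k)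
    {u : EuclideanSpace ℝ (Fin d)} (hu : HasAsymptoticDirection (fun n => γ n) u) :
    HasAsymptoticDirection (walk α ω x) u := by
  rw [← HasAsymptoticDirection.shift_iff (n + k.natAbs)]
  have h1 := (HasAsymptoticDirection.shift_iff (k + k.natAbs).toNat).2 hu
  convert h1 using 2 with m
  have e1 : ((m + (k + k.natAbs).toNat : ℕ) : ℤ) = k + (k.natAbs + m : ℕ) := by lia
  rw [e1, ← h.walk_eq, show m + (n + k.natAbs) = n + (k.natAbs + m) by ring, walk_add, hnk]

/-- The points on the bi-infinite trajectories through the origin. -/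
def originTrajectory (α : Ω → (Fin d → ℤ)) (ω : Ω) : Set (Fin d → ℤ) :=
  {z | z +ᵥ ω ∈ biinfiniteSet α ∧ ∃ n, walk α ω z n = 0 ∨ walk α ω 0 n = z}

lemma IsBiinfinite.mem_originTrajectory {γ : ℤ → (Fin d → ℤ)} (h : IsBiinfinite α ω γ)
    (h0 : γ 0 = 0) (k : ℤ) : γ k ∈ originTrajectory α ω := by
  refine ⟨h.vadd_mem k, ?_⟩
  obtain ⟨n, rfl | rfl⟩ := k.eq_nat_or_neg
  · exact ⟨n, Or.inr (by rw [← h0, h.walk_eq, zero_add])⟩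
  · exact ⟨n, Or.inl (by rw [h.walk_eq, neg_add_cancel, h0])⟩

lemma IsBiinfinite.eq_of_walk_eq {γ : ℤ → (Fin d → ℤ)} (h : IsBiinfinite α ω γ)
    (hω : ω ∈ nonMerging α) {n : ℕ} {z : Fin d → ℤ} (hz : z +ᵥ ω ∈ biinfiniteSet α) {k : ℤ}
    (hw : walk α ω z n = γ k) : z = γ (k - n) := by
  induction n generalizing z with
  | zero => simpa [walk] using hw
  | succ n ih =>
    have h1 : walk α ω (z + α (z +ᵥ ω)) n = γ k := by
      rw [← hw, add_comm n 1, walk_add]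
      rfl
    have h2 : (z + α (z +ᵥ ω)) +ᵥ ω = arrowMap α (z +ᵥ ω) := by
      rw [arrowMap, vadd_vadd, add_comm]
    have h3 := ih (by rw [h2]; exact arrowMap_mem hz) h1
    have h4 := mem_entrySet_arrow hz
    rw [← h2] at h4
    have h5 := h (k - (n + 1 : ℕ))
    rw [show k - ((n + 1 : ℕ) : ℤ) + 1 = k - n by push_cast; ring] at h5
    have h6 := mem_entrySet_arrow (h.vadd_mem (k - (n + 1 : ℕ)))
    rw [arrowMap, vadd_vadd, add_comm (α _), ← h5, ← h3] at h6
    have h7 := hω _ _ _ h4 h6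
    rw [h5, ← h7] at h3
    exact add_right_cancel h3

lemma IsBiinfinite.exists_of_mem_originTrajectory {γ : ℤ → (Fin d → ℤ)}
    (h : IsBiinfinite α ω γ) (h0 : γ 0 = 0) (hω : ω ∈ nonMerging α) {z : Fin d → ℤ}
    (hz : z ∈ originTrajectory α ω) : ∃ k, z = γ k := by
  obtain ⟨hz, n, hn | hn⟩ := hz
  · exact ⟨_, h.eq_of_walk_eq hω hz (hn.trans h0.symm)⟩
  · refine ⟨0 + n, ?_⟩
    rw [← h.walk_eq, h0, hn]

/-- The configurations in which the bi-infinite trajectories through the origin stay in the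
region `|z j| ≤ C (1 + |z i|)`. -/
def boundedSlopeSet (α : Ω → (Fin d → ℤ)) (i j : Fin d) (C : ℕ) : Set Ω :=
  {ω | ω ∈ biinfiniteSet α ∧ ∀ z ∈ originTrajectory α ω, |z j| ≤ C * (1 + |z i|)}

lemma measurableSet_boundedSlopeSet [MeasurableSpace Ω] [MeasurableConstVAdd (Fin d → ℤ) Ω]
    (hα : Measurable α) (hA : IsArrowField α) (i j : Fin d) (C : ℕ) :
    MeasurableSet (boundedSlopeSet α i j C) := by
  have hS := measurableSet_biinfiniteSet hα hA
  have : boundedSlopeSet α i j C = biinfiniteSet α ∩ ⋂ z : Fin d → ℤ,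
      (((z +ᵥ ·) ⁻¹' biinfiniteSet α ∩
        ⋃ n, ((fun ω => walk α ω z n) ⁻¹' {0} ∪ (fun ω => walk α ω 0 n) ⁻¹' {z}))ᶜ ∪
        {_ω | |z j| ≤ C * (1 + |z i|)}) := by
    ext ω
    simp only [boundedSlopeSet, originTrajectory, Set.mem_ofPred_eq, Set.mem_inter_iff,
      Set.mem_iInter, Set.mem_union, Set.mem_compl_iff, Set.mem_iUnion, Set.mem_preimage,
      Set.mem_singleton_iff]
    grind
  rw [this]
  exact hS.inter (MeasurableSet.iInter fun z => (((hS.preimage (measurable_const_vadd z)).inter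
    (MeasurableSet.iUnion fun n => (measurable_walk hα z n (measurableSet_singleton _)).union
      (measurable_walk hα 0 n (measurableSet_singleton _)))).compl).union (MeasurableSet.const _))

lemma exists_isBiinfinite_of_mem_boundedSlopeSet {i j : Fin d} {C : ℕ} {w : Fin d → ℤ}
    (h : w +ᵥ ω ∈ boundedSlopeSet α i j C) :
    ∃ γ, IsBiinfinite α ω γ ∧ ∀ k, |γ k j - w j| ≤ C * (1 + |γ k i - w i|) := by
  obtain ⟨⟨γ, hγ, h0⟩, hb⟩ := h
  refine ⟨_, hγ.of_translate, fun k => ?_⟩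
  have := hb _ (hγ.mem_originTrajectory h0 k)
  simpa using this

/-- Almost surely, the set `A` recurs in both directions of every coordinate axis. -/
lemma ae_frequently_vadd_mem [MeasurableSpace Ω] [MeasurableConstVAdd (Fin d → ℤ) Ω]
    {P : Measure Ω} [VAddInvariantMeasure (Fin d → ℤ) Ω P] [IsProbabilityMeasure P]
    {A : Set Ω} (hA : MeasurableSet A) :
    ∀ᵐ ω ∂P, ∀ z e : Fin d → ℤ, z +ᵥ ω ∈ A → ∃ᶠ n : ℕ in atTop, (n • e + z) +ᵥ ω ∈ A := by
  have h : ∀ᵐ ω ∂P, ∀ e : Fin d → ℤ, ω ∈ A → ∃ᶠ n : ℕ in atTop, (n • e) +ᵥ ω ∈ A := by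
    rw [ae_all_iff]
    intro e
    filter_upwards [(measurePreserving_vadd e P).conservative.ae_mem_imp_frequently_image_mem
      hA.nullMeasurableSet] with ω hω h
    simpa only [vadd_iterate_apply] using hω h
  filter_upwards [ae_forall_vadd (d := d) h] with ω hω z e hz
  simpa only [add_vadd] using hω z e hz

end meeting

section plane

variable {Ω : Type*} [AddAction (Fin 2 → ℤ) Ω] {α : Ω → (Fin 2 → ℤ)} {ω : Ω}

lemma IsBiinfinite.neighbors_coords {γ : ℤ → (Fin 2 → ℤ)} (h : IsBiinfinite α ω γ)
    (hA : IsArrowField α) {i j : Fin 2} (hij : i ≠ j) (k : ℤ) :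
    Neighbors (coords i j (γ k)) (coords i j (γ (k + 1))) := by
  rw [h]
  exact ArrowWalk.neighbors_coords hA hij _ _

/-- Two bi-infinite trajectories of a planar configuration have parallel velocities. -/
theorem IsBiinfinite.velocity_apply_eq (hA : IsArrowField α) {γ γ' : ℤ → (Fin 2 → ℤ)}
    (h : IsBiinfinite α ω γ) (h' : IsBiinfinite α ω γ') {v v' : EuclideanSpace ℝ (Fin 2)}
    (hv : HasAsymptoticVelocity (fun n => γ n) v)
    (hvn : HasAsymptoticVelocity (fun n => γ (-n)) (-v))
    (hv' : HasAsymptoticVelocity (fun n => γ' n) v')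
    (hvn' : HasAsymptoticVelocity (fun n => γ' (-n)) (-v')) {i j : Fin 2} (hij : i ≠ j)
    (hvi : v i ≠ 0) : v' j = v j / v i * v' i := by
  by_cases hmeet : ∃ k l, γ k = γ' l
  · obtain ⟨k, l, hkl⟩ := hmeet
    rw [← h.velocity_eq_of_meet h' hkl hv hv', div_mul_cancel₀ _ hvi]
  · push Not at hmeet
    exact (hasPlanarVelocity_coords hv hvn i j).eq_mul_of_disjoint
      (hasPlanarVelocity_coords hv' hvn' i j) hvi (h.neighbors_coords hA hij)
      (h'.neighbors_coords hA hij)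
      fun k l heq => hmeet l k (coords_injective hij heq).symm

lemma IsBiinfinite.exists_mem_boundedSlopeSet {γ : ℤ → (Fin 2 → ℤ)} (h : IsBiinfinite α ω γ)
    (hω : ω ∈ nonMerging α) {v : EuclideanSpace ℝ (Fin 2)}
    (hv : HasAsymptoticVelocity (fun n => γ n) v)
    (hvn : HasAsymptoticVelocity (fun n => γ (-n)) (-v)) {i : Fin 2} (j : Fin 2)
    (hvi : v i ≠ 0) : ∃ C, γ 0 +ᵥ ω ∈ boundedSlopeSet α i j C := by
  set γ' : ℤ → (Fin 2 → ℤ) := fun k => γ (0 + k) - γ 0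
  have hγ' : IsBiinfinite α (γ 0 +ᵥ ω) γ' := h.translate (γ 0) 0
  have h0' : γ' 0 = 0 := by simp [γ']
  have hv' : HasAsymptoticVelocity (fun n => γ' n) v := by
    simpa [γ', sub_eq_add_neg] using hv.add_const (-γ 0)
  have hvn' : HasAsymptoticVelocity (fun n => γ' (-n)) (-v) := by
    simpa [γ', sub_eq_add_neg] using hvn.add_const (-γ 0)
  obtain ⟨C, hC⟩ := (hasPlanarVelocity_coords hv' hvn' i j).exists_abs_sub_slope_mul_le hvi one_pos
  obtain ⟨N, hN⟩ := exists_nat_ge (|C| + 1 + |v j / v i|)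
  refine ⟨N, h.vadd_mem 0, fun z hz => ?_⟩
  obtain ⟨k, rfl⟩ := hγ'.exists_of_mem_originTrajectory h0' (vadd_mem_nonMerging hω _) hz
  have h1 := hC k
  simp only [coords] at h1
  have h2 : |(γ' k j : ℝ)| ≤ |(γ' k j : ℝ) - v j / v i * γ' k i| + |v j / v i| * |(γ' k i : ℝ)| := by
    have := abs_add_le ((γ' k j : ℝ) - v j / v i * γ' k i) (v j / v i * γ' k i)
    rwa [sub_add_cancel, abs_mul (v j / v i)] at this
  have h3 : |(γ' k j : ℝ)| ≤ N * (1 + |(γ' k i : ℝ)|) := by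
    have h4 := abs_nonneg (γ' k i : ℝ)
    have h5 := mul_le_mul_of_nonneg_right hN h4
    have h6 := mul_nonneg (abs_nonneg C) h4
    have h7 := abs_nonneg (v j / v i)
    linarith [le_abs_self C]
  exact_mod_cast h3

/-- Almost surely, all walks of a line-crossing planar configuration follow the direction of each
of its bi-infinite trajectories, up to orientation. -/
theorem ae_hasAsymptoticDirection_walk [MeasurableSpace Ω] [MeasurableConstVAdd (Fin 2 → ℤ) Ω]
    {P : Measure Ω} [VAddInvariantMeasure (Fin 2 → ℤ) Ω P] [IsProbabilityMeasure P]
    (hα : Measurable α) (hA : IsArrowField α) {l : Fin 2 → ℤ} (hl : LineCrossing P α l) :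
    ∀ᵐ ω ∂P, ∀ γ v, IsBiinfinite α ω γ → HasAsymptoticVelocity (fun n => γ n) v → ∀ x,
      HasAsymptoticDirection (walk α ω x) (‖v‖⁻¹ • v) ∨
        HasAsymptoticDirection (walk α ω x) (-(‖v‖⁻¹ • v)) := by
  have hrec : ∀ᵐ ω ∂P, ∀ i j C, ∀ z e : Fin 2 → ℤ, z +ᵥ ω ∈ boundedSlopeSet α i j C →
      ∃ᶠ n : ℕ in atTop, (n • e + z) +ᵥ ω ∈ boundedSlopeSet α i j C := by
    simp only [ae_all_iff (ι := Fin 2), ae_all_iff (ι := ℕ)]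
    exact fun i j C => ae_frequently_vadd_mem (measurableSet_boundedSlopeSet hα hA i j C)
  filter_upwards [hrec, hl, ae_mem_nonMerging (P := P) hα hA, ae_exists_velocity (P := P) hα hA,
    ae_velocity_ne_zero hα hA hl] with ω hrec hline hmerge hvel hne γ v hγ hv x
  have hvel' : ∀ γ v, IsBiinfinite α ω γ → HasAsymptoticVelocity (fun n => γ n) v →
      HasAsymptoticVelocity (fun n => γ (-n)) (-v) := by
    intro γ v hγ hv
    obtain ⟨w, hw, hw'⟩ := hvel γ hγ
    rwa [hv.unique hw]
  have hv0 := hne γ hγ v hv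
  obtain ⟨i, hi⟩ : ∃ i, v i ≠ 0 := by
    by_contra! hcon
    exact hv0 (by ext i; simp [hcon])
  obtain ⟨j, hij⟩ : ∃ j, i ≠ j := ⟨i + 1, by lia⟩
  have hpar : ∀ γ' v', IsBiinfinite α ω γ' → HasAsymptoticVelocity (fun n => γ' n) v' →
      ∃ c : ℝ, c ≠ 0 ∧ v' = c • v := by
    intro γ' v' hγ' hv'
    have h1 := eq_smul_of_apply_eq hij hi (hγ.velocity_apply_eq hA hγ' hv (hvel' _ _ hγ hv) hv'
      (hvel' _ _ hγ' hv') hij hi)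
    refine ⟨_, fun hc => hne γ' hγ' v' hv' ?_, h1⟩
    rw [h1, hc, zero_smul]
  by_cases hmeet : ∃ γ', IsBiinfinite α ω γ' ∧ ∃ n k, walk α ω x n = γ' k
  · obtain ⟨γ', hγ', n, k, hnk⟩ := hmeet
    obtain ⟨v', hv', -⟩ := hvel γ' hγ'
    have hdir := hγ'.hasAsymptoticDirection_walk_of_meet hnk
      (hv'.hasAsymptoticDirection (hne γ' hγ' v' hv'))
    obtain ⟨c, hc, rfl⟩ := hpar γ' v' hγ' hv'
    rcases lt_or_gt_of_ne hc with h | h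
    · rw [inv_norm_smul_of_neg h] at hdir
      exact Or.inr hdir
    · rw [inv_norm_smul_of_pos h] at hdir
      exact Or.inl hdir
  · push Not at hmeet
    obtain ⟨C, hC⟩ := hγ.exists_mem_boundedSlopeSet hmerge hv (hvel' _ _ hγ hv) j hi
    set T : ℤ := |x j| + |γ 0 j| + C * (1 + |x i - γ 0 i|) with hT
    have hside : ∀ s : ℤ, ∃ γ', IsBiinfinite α ω γ' ∧ ∃ n : ℕ, T < n ∧
        ∀ k, γ' k i = x i → |γ' k j - (n * s + γ 0 j)| ≤ C * (1 + |x i - γ 0 i|) := by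
      intro s
      obtain ⟨n, hn, hnT⟩ := ((hrec i j C (γ 0) (Pi.single j s) hC).and_eventually
        (eventually_gt_atTop T.toNat)).exists
      obtain ⟨γ', hγ', hb⟩ := exists_isBiinfinite_of_mem_boundedSlopeSet hn
      refine ⟨γ', hγ', n, by lia, fun k hk => ?_⟩
      have h1 := hb k
      simpa [hk, hij] using h1
    obtain ⟨γ₁, hγ₁, n₁, hn₁, hb₁⟩ := hside (-1)
    obtain ⟨γ₂, hγ₂, n₂, hn₂, hb₂⟩ := hside 1
    obtain ⟨v₁, hv₁, hvn₁⟩ := hvel γ₁ hγ₁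
    obtain ⟨v₂, hv₂, hvn₂⟩ := hvel γ₂ hγ₂
    obtain ⟨c₁, hc₁, rfl⟩ := hpar γ₁ v₁ hγ₁ hv₁
    obtain ⟨c₂, hc₂, rfl⟩ := hpar γ₂ v₂ hγ₂ hv₂
    have hXn : ∀ k, Neighbors (coords i j (walk α ω x k)) (coords i j (walk α ω x (k + 1))) :=
      fun k => neighbors_coords hA hij _ _
    have hlin : ∀ ε : ℝ, 0 < ε → ∃ C, ∀ n, |((coords i j (walk α ω x n)).2 : ℝ) -
        v j / v i * (coords i j (walk α ω x n)).1| ≤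
          C + ε * |((coords i j (walk α ω x n)).1 : ℝ)| := by
      intro ε hε
      refine exists_abs_sub_slope_mul_le_of_between (X := fun n => coords i j (walk α ω x n))
        (hasPlanarVelocity_coords hv₁ hvn₁ i j)
        (hasPlanarVelocity_coords hv₂ hvn₂ i j) (by simp [hc₁, hi]) (by simp [hc₂, hi])
        (by simp [mul_div_mul_left _ _ hc₁]) (by simp [mul_div_mul_left _ _ hc₂])
        (hγ₁.neighbors_coords hA hij) (hγ₂.neighbors_coords hA hij) hXn
        (fun n k h => hmeet γ₁ hγ₁ n k (coords_injective hij h))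
        (fun n k h => hmeet γ₂ hγ₂ n k (coords_injective hij h)) ?_ ?_ hε
      · intro k hk
        have h1 := abs_le.1 (hb₁ k hk)
        have h2 := neg_abs_le (x j)
        have h3 := le_abs_self (γ 0 j)
        simp only [coords, walk]
        linarith
      · intro k hk
        have h1 := abs_le.1 (hb₂ k hk)
        have h2 := le_abs_self (x j)
        have h3 := neg_abs_le (γ 0 j)
        simp only [coords, walk]
        linarith
    have htr : ∀ p, {n | coords i j (walk α ω x n) = p}.Finite := by
      intro p
      rcases Set.eq_empty_or_nonempty {n | coords i j (walk α ω x n) = p} with h | ⟨m, hm⟩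
      · rw [h]
        exact Set.finite_empty
      · refine (hline x (∑ i, l i * walk α ω x m i)).subset fun n hn => ?_
        have : walk α ω x n = walk α ω x m :=
          coords_injective hij (Eq.trans hn (Eq.symm hm))
        simp [this]
    obtain ⟨hsign, hslope⟩ := tendsto_slope_of_transient hXn htr hlin
    exact hasAsymptoticDirection_of_slope hij hi hsign hslope

end plane

section ergodic

variable {d : ℕ} {Ω : Type*} [AddAction (Fin d → ℤ) Ω] [MeasurableSpace Ω]
  [MeasurableConstVAdd (Fin d → ℤ) Ω] {P : Measure Ω}

lemma ae_exists_vadd_mem [ErgodicVAdd (Fin d → ℤ) Ω P] {A : Set Ω} (hA : MeasurableSet A)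
    (h : P A ≠ 0) : ∀ᵐ ω ∂P, ∃ z : Fin d → ℤ, z +ᵥ ω ∈ A := by
  set B : Set Ω := {ω | ∃ z : Fin d → ℤ, z +ᵥ ω ∈ A} with hB
  have hBm : MeasurableSet B := by
    have : B = ⋃ z : Fin d → ℤ, (z +ᵥ ·) ⁻¹' A := by ext; simp [hB]
    rw [this]
    exact MeasurableSet.iUnion fun z => hA.preimage (measurable_const_vadd z)
  have hinv : ∀ g : Fin d → ℤ, (g +ᵥ ·) ⁻¹' B = B := by
    intro g
    ext ω
    constructor
    · rintro ⟨z, hz⟩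
      exact ⟨z + g, by rwa [add_vadd]⟩
    · rintro ⟨z, hz⟩
      exact ⟨z - g, by rwa [vadd_vadd, sub_add_cancel]⟩
  rcases eventuallyConst_set.1 (ErgodicVAdd.aeconst_of_forall_preimage_vadd_ae_eq (μ := P) hBm
    fun g => ae_of_all _ fun ω => congrFun (hinv g) ω) with h1 | h1
  · exact h1
  · refine absurd (measure_mono_null (fun ω hω => ?_) (measure_eq_zero_iff_ae_notMem.2 h1)) h
    exact ⟨0, by rwa [zero_vadd]⟩

/-- In an ergodic system, a random vector which does not vanish identically has a nonzero value
which is almost surely approached by its translates. -/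
lemma exists_ae_forall_exists_vadd_dist_lt [ErgodicVAdd (Fin d → ℤ) Ω P]
    {f : Ω → EuclideanSpace ℝ (Fin d)} (hf : Measurable f) (h : ¬ ∀ᵐ ω ∂P, f ω = 0) :
    ∃ v₀, v₀ ≠ 0 ∧ ∀ᵐ ω ∂P, ∀ ε : ℝ, 0 < ε → ∃ z : Fin d → ℤ, dist (f (z +ᵥ ω)) v₀ < ε := by
  have h0 : (P.map f) {0}ᶜ ≠ 0 := by
    rw [Measure.map_apply hf (measurableSet_singleton _).compl]
    exact h
  obtain ⟨v₀, hv₀, hpos⟩ := exists_mem_forall_mem_nhdsWithin_pos_measure h0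
  refine ⟨v₀, hv₀, ?_⟩
  have hn : ∀ᵐ ω ∂P, ∀ n : ℕ, ∃ z : Fin d → ℤ, dist (f (z +ᵥ ω)) v₀ < 1 / ((n : ℝ) + 1) := by
    rw [ae_all_iff]
    intro n
    refine ae_exists_vadd_mem (A := f ⁻¹' Metric.ball v₀ (1 / ((n : ℝ) + 1)))
      (hf measurableSet_ball) ?_
    rw [← Measure.map_apply hf measurableSet_ball]
    exact (hpos _ (mem_nhdsWithin_of_mem_nhds (Metric.ball_mem_nhds _ (by positivity)))).ne'
  filter_upwards [hn] with ω hω ε hε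
  obtain ⟨n, hn⟩ := exists_nat_one_div_lt hε
  obtain ⟨z, hz⟩ := hω n
  exact ⟨z, hz.trans hn⟩

end ergodic

section velocity

variable {d : ℕ} {Ω : Type*} [AddAction (Fin d → ℤ) Ω] [MeasurableSpace Ω]
  [MeasurableConstVAdd (Fin d → ℤ) Ω] {P : Measure Ω} [VAddInvariantMeasure (Fin d → ℤ) Ω P]
  [IsProbabilityMeasure P] {α : Ω → (Fin d → ℤ)}

/-- The velocity of the bi-infinite trajectories is a measurable function of the configuration
seen from one of their points. -/
lemma exists_measurable_velocity (hα : Measurable α) (hA : IsArrowField α) :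
    ∃ f : Ω → EuclideanSpace ℝ (Fin d), Measurable f ∧ ∀ᵐ ω ∂P,
      (∀ γ v, IsBiinfinite α ω γ → HasAsymptoticVelocity (fun n => γ n) v →
        v = f (γ 0 +ᵥ ω)) ∧
      ∀ z : Fin d → ℤ, f (z +ᵥ ω) ≠ 0 →
        ∃ γ, IsBiinfinite α ω γ ∧ HasAsymptoticVelocity (fun n => γ n) (f (z +ᵥ ω)) := by
  have hwalk : ∀ (ω : Ω) γ, IsBiinfinite α ω γ → γ 0 = 0 → (fun n : ℕ => γ n) = walk α ω 0 := by
    intro ω γ hγ h0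
    ext1 n
    rw [← h0, hγ.walk_eq, zero_add]
  have hm : ∀ n : ℕ, AEMeasurable ((biinfiniteSet α).indicator
      fun ω => (n : ℝ)⁻¹ • toEuc (walk α ω 0 n)) P := by
    intro n
    have h1 : Measurable fun ω => toEuc (walk α ω 0 n) :=
      (measurable_of_countable toEuc).comp (measurable_walk hα 0 n)
    have h2 : Measurable fun ω => (n : ℝ)⁻¹ • toEuc (walk α ω 0 n) :=
      h1.const_smul (n : ℝ)⁻¹
    exact (h2.indicator (measurableSet_biinfiniteSet hα hA)).aemeasurable
  obtain ⟨f, hf, hlim⟩ := measurable_limit_of_tendsto_metrizable_ae (L := atTop) hm (by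
    filter_upwards [ae_exists_velocity (P := P) hα hA] with ω hω
    by_cases hS : ω ∈ biinfiniteSet α
    · obtain ⟨γ, hγ, h0⟩ := id hS
      obtain ⟨v, hv, -⟩ := hω γ hγ
      rw [hwalk ω γ hγ h0] at hv
      exact ⟨v, by simp only [Set.indicator_of_mem hS]; exact hv⟩
    · exact ⟨0, by simpa only [Set.indicator_of_notMem hS] using tendsto_const_nhds⟩)
  refine ⟨f, hf, ?_⟩
  filter_upwards [ae_forall_vadd (d := d) hlim] with ω hω
  have key : ∀ γ, IsBiinfinite α ω γ →
      HasAsymptoticVelocity (fun n => γ n) (f (γ 0 +ᵥ ω)) := by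
    intro γ hγ
    have h1 := hω (γ 0)
    simp only [Set.indicator_of_mem (hγ.vadd_mem 0)] at h1
    have h2 : HasAsymptoticVelocity (walk α (γ 0 +ᵥ ω) 0) (f (γ 0 +ᵥ ω)) := h1
    have h3 := h2.add_const (γ 0)
    convert h3 using 2 with n
    rw [← walk_eq_add_walk_vadd, hγ.walk_eq, zero_add]
  refine ⟨fun γ v hγ hv => hv.unique (key γ hγ), fun z hz => ?_⟩
  have hS : z +ᵥ ω ∈ biinfiniteSet α := by
    by_contra hS
    have h1 := hω z
    simp only [Set.indicator_of_notMem hS] at h1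
    exact hz (tendsto_nhds_unique h1 tendsto_const_nhds)
  obtain ⟨γ, hγ, h0⟩ := exists_isBiinfinite_of_vadd_mem hS
  exact ⟨γ, hγ, h0 ▸ key γ hγ⟩

end velocity

section plane

variable {Ω : Type*} [AddAction (Fin 2 → ℤ) Ω] {α : Ω → (Fin 2 → ℤ)}

lemma exists_eq_smul_of_cross_eq {v w : EuclideanSpace ℝ (Fin 2)} (hv : v ≠ 0)
    (h : v 0 * w 1 = v 1 * w 0) : ∃ c : ℝ, w = c • v := by
  by_cases h0 : v 0 = 0
  · have h1 : v 1 ≠ 0 := fun h1 => hv (by ext i; fin_cases i <;> simp [h0, h1])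
    refine ⟨_, eq_smul_of_apply_eq (i := 1) (j := 0) (by decide) h1 ?_⟩
    field_simp
    linarith
  · refine ⟨_, eq_smul_of_apply_eq (i := 0) (j := 1) (by decide) h0 ?_⟩
    field_simp
    linarith

lemma exists_eq_smul_inv_norm_smul {v w : EuclideanSpace ℝ (Fin 2)} (hv : v ≠ 0)
    (h : v 0 * w 1 = v 1 * w 0) : ∃ c : ℝ, w = c • (‖v‖⁻¹ • v) := by
  obtain ⟨c, rfl⟩ := exists_eq_smul_of_cross_eq hv h
  refine ⟨c * ‖v‖, ?_⟩
  rw [smul_smul, mul_assoc, mul_inv_cancel₀ (norm_ne_zero_iff.2 hv), mul_one]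

/-- A unit vector along a nonzero multiple of `u` is `u` or `-u`. -/
lemma inv_norm_smul_smul_eq_or {u : EuclideanSpace ℝ (Fin 2)} (hu : ‖u‖ = 1) {c : ℝ}
    (hc : c ≠ 0) : ‖c • u‖⁻¹ • (c • u) = u ∨ ‖c • u‖⁻¹ • (c • u) = -u := by
  rcases lt_or_gt_of_ne hc with h | h
  · exact Or.inr (by rw [inv_norm_smul_of_neg h, hu, inv_one, one_smul])
  · exact Or.inl (by rw [inv_norm_smul_of_pos h, hu, inv_one, one_smul])

/-- If the velocities are multiples of the unit vector `u`, then all walks have direction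
`u` or `-u`. -/
lemma hasAsymptoticDirection_of_common_line {ω : Ω} {u : EuclideanSpace ℝ (Fin 2)}
    (hu : ‖u‖ = 1) {x : Fin 2 → ℤ} {v : EuclideanSpace ℝ (Fin 2)} (hv0 : v ≠ 0)
    (hvu : ∃ c : ℝ, v = c • u)
    (h : HasAsymptoticDirection (walk α ω x) (‖v‖⁻¹ • v) ∨
      HasAsymptoticDirection (walk α ω x) (-(‖v‖⁻¹ • v))) :
    HasAsymptoticDirection (walk α ω x) u ∨ HasAsymptoticDirection (walk α ω x) (-u) := by
  obtain ⟨c, rfl⟩ := hvu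
  have hc : c ≠ 0 := fun hc => hv0 (by rw [hc, zero_smul])
  rcases inv_norm_smul_smul_eq_or hu hc with h1 | h1
  · rwa [h1] at h
  · rw [h1, neg_neg] at h
    exact h.symm

/-- Directed walks move in the direction of positive coordinate sum. -/
lemma IsDirected.sum_nonneg_of_hasAsymptoticDirection (hD : IsDirected α) {ω : Ω}
    {x : Fin 2 → ℤ} {u : EuclideanSpace ℝ (Fin 2)}
    (h : HasAsymptoticDirection (walk α ω x) u) : 0 ≤ u 0 + u 1 := by
  have hsum : ∀ n : ℕ, walk α ω x n 0 + walk α ω x n 1 = x 0 + x 1 + n := by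
    intro n
    induction n with
    | zero => simp [walk]
    | succ n ih =>
      obtain ⟨i, hi⟩ := hD (walk α ω x n +ᵥ ω)
      have : α (walk α ω x n +ᵥ ω) 0 + α (walk α ω x n +ᵥ ω) 1 = 1 := by
        rw [hi]
        fin_cases i <;> simp
      simp only [walk, Pi.add_apply]
      push_cast
      linarith
  have h2 := tendsto_toLp_iff.1 h.2
  refine ge_of_tendsto ((h2 0).add (h2 1)) ?_
  filter_upwards [eventually_ge_atTop (x 0 + x 1).natAbs] with n hn
  simp only [PiLp.smul_apply, smul_eq_mul, toEuc]
  rw [← mul_add]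
  refine mul_nonneg (by positivity) ?_
  have : 0 ≤ walk α ω x n 0 + walk α ω x n 1 := by rw [hsum]; lia
  exact_mod_cast this

/-- Directed walks choose the same orientation of a line that is not orthogonal to the
diagonal. -/
lemma IsDirected.exists_oriented (hD : IsDirected α) (u : EuclideanSpace ℝ (Fin 2)) :
    ∃ u' : EuclideanSpace ℝ (Fin 2), ∀ ω x,
      (u 0 + u 1 ≠ 0) →
      (HasAsymptoticDirection (walk α ω x) u ∨ HasAsymptoticDirection (walk α ω x) (-u)) →
      HasAsymptoticDirection (walk α ω x) u' := by
  rcases le_or_gt 0 (u 0 + u 1) with h | h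
  · refine ⟨u, fun ω x h0 hx => hx.resolve_right fun h1 => h0 (le_antisymm ?_ h)⟩
    have := hD.sum_nonneg_of_hasAsymptoticDirection h1
    simp only [PiLp.neg_apply] at this
    linarith
  · refine ⟨-u, fun ω x h0 hx => hx.resolve_left fun h1 => ?_⟩
    linarith [hD.sum_nonneg_of_hasAsymptoticDirection h1]

/-- The velocity of a directed walk has coordinate sum `1`. -/
lemma IsDirected.sum_velocity (hD : IsDirected α) {ω : Ω} {γ : ℤ → (Fin 2 → ℤ)}
    (hγ : IsBiinfinite α ω γ) {v : EuclideanSpace ℝ (Fin 2)}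
    (hv : HasAsymptoticVelocity (fun n => γ n) v) : v 0 + v 1 = 1 := by
  have hsum : ∀ n : ℕ, γ n 0 + γ n 1 = γ 0 0 + γ 0 1 + n := by
    intro n
    induction n with
    | zero => simp
    | succ n ih =>
      obtain ⟨i, hi⟩ := hD (γ n +ᵥ ω)
      have : α (γ n +ᵥ ω) 0 + α (γ n +ᵥ ω) 1 = 1 := by
        rw [hi]
        fin_cases i <;> simp
      push_cast
      rw [hγ n]
      simp only [Pi.add_apply]
      linarith
  rw [hasAsymptoticVelocity_iff] at hv
  have h1 := (hv 0).add (hv 1)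
  have h2 : Tendsto (fun n : ℕ => (n : ℝ)⁻¹ * (γ 0 0 + γ 0 1 : ℤ) + 1) atTop
      (𝓝 (0 * (γ 0 0 + γ 0 1 : ℤ) + 1)) :=
    ((tendsto_inv_atTop_nhds_zero_nat (𝕜 := ℝ)).mul_const _).add_const 1
  rw [zero_mul, zero_add] at h2
  refine tendsto_nhds_unique h1 (h2.congr' ?_)
  filter_upwards [eventually_gt_atTop 0] with n hn
  have hn' : (n : ℝ) ≠ 0 := by positivity
  have h3 : ((γ n 0 : ℤ) : ℝ) + (γ n 1 : ℤ) = (γ 0 0 + γ 0 1 : ℤ) + n := by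
    exact_mod_cast hsum n
  rw [← mul_add, h3, mul_add, inv_mul_cancel₀ hn']

variable [MeasurableSpace Ω] [MeasurableConstVAdd (Fin 2 → ℤ) Ω] {P : Measure Ω}
  [IsProbabilityMeasure P]

/-- Almost surely, the bi-infinite trajectories of a planar configuration have parallel
velocities. -/
theorem ae_velocity_cross_eq [VAddInvariantMeasure (Fin 2 → ℤ) Ω P] (hα : Measurable α)
    (hA : IsArrowField α) :
    ∀ᵐ ω ∂P, ∀ γ γ' v v', IsBiinfinite α ω γ → IsBiinfinite α ω γ' →
      HasAsymptoticVelocity (fun n => γ n) v → HasAsymptoticVelocity (fun n => γ' n) v' →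
      v 0 * v' 1 = v 1 * v' 0 := by
  filter_upwards [ae_exists_velocity (P := P) hα hA] with ω hω γ γ' v v' hγ hγ' hv hv'
  obtain ⟨w, hw, hwn⟩ := hω γ hγ
  obtain ⟨w', hw', hwn'⟩ := hω γ' hγ'
  obtain rfl := hv.unique hw
  obtain rfl := hv'.unique hw'
  by_cases h0 : v 0 = 0
  · by_cases h1 : v 1 = 0
    · rw [h0, h1, zero_mul, zero_mul]
    · rw [hγ.velocity_apply_eq hA hγ' hv hwn hv' hwn' (i := 1) (j := 0) (by decide) h1, h0]
      simp
  · rw [hγ.velocity_apply_eq hA hγ' hv hwn hv' hwn' (i := 0) (j := 1) (by decide) h0]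
    field_simp

/-- Almost surely, the velocities of all bi-infinite trajectories of a planar configuration lie
on one line. -/
theorem ae_exists_common_line [VAddInvariantMeasure (Fin 2 → ℤ) Ω P] (hα : Measurable α)
    (hA : IsArrowField α) :
    ∀ᵐ ω ∂P, ∃ u : EuclideanSpace ℝ (Fin 2), ‖u‖ = 1 ∧ ∀ γ v, IsBiinfinite α ω γ →
      HasAsymptoticVelocity (fun n => γ n) v → ∃ c : ℝ, v = c • u := by
  filter_upwards [ae_velocity_cross_eq (P := P) hα hA] with ω hω
  by_cases h : ∃ γ v, IsBiinfinite α ω γ ∧ HasAsymptoticVelocity (fun n => γ n) v ∧ v ≠ 0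
  · obtain ⟨γ, v, hγ, hv, hv0⟩ := h
    exact ⟨‖v‖⁻¹ • v, norm_inv_norm_smul hv0, fun γ' v' hγ' hv' =>
      exists_eq_smul_inv_norm_smul hv0 (hω γ γ' v v' hγ hγ' hv hv')⟩
  · push Not at h
    exact ⟨EuclideanSpace.single 0 1, by simp,
      fun γ v hγ hv => ⟨0, by rw [h γ v hγ hv, zero_smul]⟩⟩

/-- In an ergodic planar system, the line which contains the velocities is deterministic. -/
theorem exists_ae_common_line [ErgodicVAdd (Fin 2 → ℤ) Ω P] (hα : Measurable α)
    (hA : IsArrowField α) :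
    ∃ u : EuclideanSpace ℝ (Fin 2), ‖u‖ = 1 ∧ ∀ᵐ ω ∂P, ∀ γ v, IsBiinfinite α ω γ →
      HasAsymptoticVelocity (fun n => γ n) v → ∃ c : ℝ, v = c • u := by
  obtain ⟨f, hf, hfv⟩ := exists_measurable_velocity (P := P) hα hA
  by_cases h : ∀ᵐ ω ∂P, f ω = 0
  · refine ⟨EuclideanSpace.single 0 1, by simp, ?_⟩
    filter_upwards [hfv, ae_forall_vadd (d := 2) h] with ω hω h0 γ v hγ hv
    exact ⟨0, by rw [hω.1 γ v hγ hv, h0, zero_smul]⟩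
  · obtain ⟨v₀, hv₀, happ⟩ := exists_ae_forall_exists_vadd_dist_lt hf h
    refine ⟨‖v₀‖⁻¹ • v₀, norm_inv_norm_smul hv₀, ?_⟩
    filter_upwards [hfv, happ, ae_velocity_cross_eq (P := P) hα hA] with ω hω happ hcross γ v hγ hv
    refine exists_eq_smul_inv_norm_smul hv₀ ?_
    have hcl : IsClosed {w : EuclideanSpace ℝ (Fin 2) | w 0 * v 1 = w 1 * v 0} :=
      isClosed_eq (by fun_prop) (by fun_prop)
    refine hcl.closure_subset (Metric.mem_closure_iff.2 fun ε hε => ?_)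
    obtain ⟨z, hz⟩ := happ (min ε ‖v₀‖) (lt_min hε (norm_pos_iff.2 hv₀))
    have hz0 : f (z +ᵥ ω) ≠ 0 := by
      intro h0
      rw [h0, dist_zero_left] at hz
      exact absurd (hz.trans_le (min_le_right _ _)) (lt_irrefl _)
    obtain ⟨γ', hγ', hv'⟩ := hω.2 z hz0
    exact ⟨f (z +ᵥ ω), hcross γ' γ _ _ hγ' hγ hv' hv, by
      rw [dist_comm]; exact hz.trans_le (min_le_left _ _)⟩

end plane

end ArrowWalk

theorem theorem2p4 {d : ℕ} {Ω : Type*} [MeasurableSpace Ω]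
    [AddAction (Fin d → ℤ) Ω] [MeasurableConstVAdd (Fin d → ℤ) Ω]
    (P : Measure Ω) [IsProbabilityMeasure P] [VAddInvariantMeasure (Fin d → ℤ) Ω P]
    (α : Ω → (Fin d → ℤ)) (hα : Measurable α) (hA : ArrowWalk.IsArrowField α) :
    -- bi-infinite trajectories form an invertible measure-preserving system
    ArrowWalk.IsInvertibleSystemOn P (ArrowWalk.biinfiniteSet α) (ArrowWalk.arrowMap α) ∧
    -- every bi-infinite trajectory has an asymptotic velocity, the same at both ends
    (∀ᵐ ω ∂P, ∀ γ : ℤ → (Fin d → ℤ), ArrowWalk.IsBiinfinite α ω γ →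
      ∃ v : EuclideanSpace ℝ (Fin d),
        ArrowWalk.HasAsymptoticVelocity (fun n => γ n) v ∧
        ArrowWalk.HasAsymptoticVelocity (fun n => γ (-n)) (-v)) ∧
    -- under the line-crossing assumption, and for directed walks, the velocity is non-zero, so
    -- that the trajectory has an asymptotic direction
    (((∃ l : Fin d → ℤ, l ≠ 0 ∧ ArrowWalk.LineCrossing P α l) ∨ ArrowWalk.IsDirected α) →
      ∀ᵐ ω ∂P, ∀ γ : ℤ → (Fin d → ℤ), ArrowWalk.IsBiinfinite α ω γ →
        ∃ v : EuclideanSpace ℝ (Fin d), v ≠ 0 ∧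
          ArrowWalk.HasAsymptoticVelocity (fun n => γ n) v ∧
          ArrowWalk.HasAsymptoticDirection (fun n => γ n) (‖v‖⁻¹ • v) ∧
          ArrowWalk.HasAsymptoticDirection (fun n => γ (-n)) (-(‖v‖⁻¹ • v))) ∧
    -- dimension two, no restriction: the velocities of the bi-infinite trajectories of a
    -- configuration are parallel to one line, a deterministic one if the system is ergodic
    (d = 2 →
      (∀ᵐ ω ∂P, ∃ u : EuclideanSpace ℝ (Fin d), ‖u‖ = 1 ∧
        ∀ γ v, ArrowWalk.IsBiinfinite α ω γ →
          ArrowWalk.HasAsymptoticVelocity (fun n => γ n) v → ∃ c : ℝ, v = c • u) ∧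
      (ErgodicVAdd (Fin d → ℤ) Ω P →
        ∃ u : EuclideanSpace ℝ (Fin d), ‖u‖ = 1 ∧ ∀ᵐ ω ∂P,
          ∀ γ v, ArrowWalk.IsBiinfinite α ω γ →
            ArrowWalk.HasAsymptoticVelocity (fun n => γ n) v → ∃ c : ℝ, v = c • u)) ∧
    -- dimension two, line-crossing walks: all walks of a configuration that contains a
    -- bi-infinite trajectory have the same asymptotic direction, up to orientation
    (d = 2 → (∃ l : Fin d → ℤ, l ≠ 0 ∧ ArrowWalk.LineCrossing P α l) →
      (∀ᵐ ω ∂P, (∃ γ, ArrowWalk.IsBiinfinite α ω γ) →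
        ∃ u : EuclideanSpace ℝ (Fin d), ∀ x : Fin d → ℤ,
          ArrowWalk.HasAsymptoticDirection (ArrowWalk.walk α ω x) u ∨
          ArrowWalk.HasAsymptoticDirection (ArrowWalk.walk α ω x) (-u)) ∧
      (ErgodicVAdd (Fin d → ℤ) Ω P →
        ∃ u : EuclideanSpace ℝ (Fin d),
          ∀ᵐ ω ∂P, (∃ γ, ArrowWalk.IsBiinfinite α ω γ) → ∀ x : Fin d → ℤ,
            ArrowWalk.HasAsymptoticDirection (ArrowWalk.walk α ω x) u ∨
            ArrowWalk.HasAsymptoticDirection (ArrowWalk.walk α ω x) (-u))) ∧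
    -- dimension two, directed walks: the same, with the orientation
    (d = 2 → ArrowWalk.IsDirected α →
      (∀ᵐ ω ∂P, (∃ γ, ArrowWalk.IsBiinfinite α ω γ) →
        ∃ u : EuclideanSpace ℝ (Fin d), ∀ x : Fin d → ℤ,
          ArrowWalk.HasAsymptoticDirection (ArrowWalk.walk α ω x) u) ∧
      (ErgodicVAdd (Fin d → ℤ) Ω P →
        ∃ u : EuclideanSpace ℝ (Fin d),
          ∀ᵐ ω ∂P, (∃ γ, ArrowWalk.IsBiinfinite α ω γ) → ∀ x : Fin d → ℤ,
            ArrowWalk.HasAsymptoticDirection (ArrowWalk.walk α ω x) u)) := by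
  refine ⟨ArrowWalk.isInvertibleSystemOn_biinfiniteSet hα hA,
    ArrowWalk.ae_exists_velocity hα hA, ?_, ?_, ?_, ?_⟩
  · intro h
    have hne : ∀ᵐ ω ∂P, ∀ γ : ℤ → (Fin d → ℤ), ArrowWalk.IsBiinfinite α ω γ →
        ∀ v : EuclideanSpace ℝ (Fin d), ArrowWalk.HasAsymptoticVelocity (fun n => γ n) v →
          v ≠ 0 := by
      rcases h with ⟨l, -, hl⟩ | hD
      · exact ArrowWalk.ae_velocity_ne_zero hα hA hl
      · exact ArrowWalk.ae_velocity_ne_zero hα hA (ArrowWalk.lineCrossing_one_of_isDirected hD)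
    filter_upwards [hne, ArrowWalk.ae_exists_velocity (P := P) hα hA] with ω hne hω γ hγ
    obtain ⟨v, hv, hv'⟩ := hω γ hγ
    have hv0 := hne γ hγ v hv
    refine ⟨v, hv0, hv, hv.hasAsymptoticDirection hv0, ?_⟩
    have := hv'.hasAsymptoticDirection (neg_ne_zero.2 hv0)
    rwa [norm_neg, smul_neg] at this
  · rintro rfl
    exact ⟨ArrowWalk.ae_exists_common_line hα hA,
      fun hE => ArrowWalk.exists_ae_common_line hα hA⟩
  · rintro rfl ⟨l, -, hl⟩
    have hdir := ArrowWalk.ae_hasAsymptoticDirection_walk hα hA hl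
    have hne := ArrowWalk.ae_velocity_ne_zero hα hA hl
    have hvel := ArrowWalk.ae_exists_velocity (P := P) hα hA
    refine ⟨?_, fun hE => ?_⟩
    · filter_upwards [hdir, hvel] with ω hdir hvel ⟨γ, hγ⟩
      obtain ⟨v, hv, -⟩ := hvel γ hγ
      exact ⟨‖v‖⁻¹ • v, hdir γ v hγ hv⟩
    · obtain ⟨u, hu, hline⟩ := ArrowWalk.exists_ae_common_line (P := P) hα hA
      refine ⟨u, ?_⟩
      filter_upwards [hdir, hvel, hne, hline] with ω hdir hvel hne hline ⟨γ, hγ⟩ x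
      obtain ⟨v, hv, -⟩ := hvel γ hγ
      exact ArrowWalk.hasAsymptoticDirection_of_common_line hu (hne γ hγ v hv)
        (hline γ v hγ hv) (hdir γ v hγ hv x)
  · rintro rfl hD
    have hl := ArrowWalk.lineCrossing_one_of_isDirected (P := P) hD
    have hdir := ArrowWalk.ae_hasAsymptoticDirection_walk hα hA hl
    have hne := ArrowWalk.ae_velocity_ne_zero hα hA hl
    have hvel := ArrowWalk.ae_exists_velocity (P := P) hα hA
    have key : ∀ {ω : Ω} {u v : EuclideanSpace ℝ (Fin 2)} {γ}, ArrowWalk.IsBiinfinite α ω γ →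
        ArrowWalk.HasAsymptoticVelocity (fun n => γ n) v → (∃ c : ℝ, v = c • u) →
        u 0 + u 1 ≠ 0 := by
      rintro ω u v γ hγ hv ⟨c, rfl⟩ h0
      have h1 := hD.sum_velocity hγ hv
      simp only [PiLp.smul_apply, smul_eq_mul] at h1
      rw [← mul_add, h0, mul_zero] at h1
      exact zero_ne_one h1
    refine ⟨?_, fun hE => ?_⟩
    · filter_upwards [hdir, hvel, hne, ArrowWalk.ae_exists_common_line (P := P) hα hA] with
        ω hdir hvel hne ⟨u, hu, hline⟩ ⟨γ, hγ⟩
      obtain ⟨u', hu'⟩ := hD.exists_oriented u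
      obtain ⟨v, hv, -⟩ := hvel γ hγ
      exact ⟨u', fun x => hu' ω x (key hγ hv (hline γ v hγ hv))
        (ArrowWalk.hasAsymptoticDirection_of_common_line hu (hne γ hγ v hv)
          (hline γ v hγ hv) (hdir γ v hγ hv x))⟩
    · obtain ⟨u, hu, hline⟩ := ArrowWalk.exists_ae_common_line (P := P) hα hA
      obtain ⟨u', hu'⟩ := hD.exists_oriented u
      refine ⟨u', ?_⟩
      filter_upwards [hdir, hvel, hne, hline] with ω hdir hvel hne hline ⟨γ, hγ⟩ x
      obtain ⟨v, hv, -⟩ := hvel γ hγ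
      exact hu' ω x (key hγ hv (hline γ v hγ hv))
        (ArrowWalk.hasAsymptoticDirection_of_common_line hu (hne γ hγ v hv)
          (hline γ v hγ hv) (hdir γ v hγ hv x))
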